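/- Let $\Omega,\varepsilon_0>0$, $T=2\pi/\Omega$, and consider $y'(t)=A(\varepsilon,t)\,y(t)$ with complex $n\times n$ coefficient matrix $A(\varepsilon,t)=\sum_{k\ge 0}\varepsilon^kA_k(t)$ for real $|\varepsilon|<\varepsilon_0$, where the $A_k$ are continuous and $T$-periodic, $\sum_k|\varepsilon|^k\sup_t\|A_k(t)\|<\infty$ for $|\varepsilon|<\varepsilon_0$, and $A_0=\operatorname{diag}(d_1,\dots,d_n)$ does not depend on $t$. Let $m_j\in\mathbb Z$ be the folding number of $d_j$, i.e. $\operatorname{Im}d_j-m_j\Omega\in[-\Omega/2,\Omega/2)$, let $F_0=A_0-\mathrm i\Omega\operatorname{diag}(m_1,\dots,m_n)$, and write $A_k^{(m)}=\frac1T\int_0^TA_k(t)e^{-\mathrm i\Omega mt}\,dt$. Suppose that $f_0$ is a degenerate point of order $2$, i.e. it occurs exactly twice on the diagonal of $F_0$, at positions which we number $1$ and $2$, and that $A_1^{(0)}=0$. Then, for all sufficiently small $|\varepsilon|$, the fundamental solution with $X(\varepsilon,0)=I$ can be written as $X(\varepsilon,t)=P(\varepsilon,t)e^{tF(\varepsilon)}$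 with $P$ $T$-periodic in $t$, $P$ and $F$ analytic in $\varepsilon$ at $0$, and $F(0)=F_0$. For every such representation, let $F(\varepsilon)=F_0+\varepsilon F_1+O(\varepsilon^2)$. Then $(F_1)_{12}=(A_1^{(m_1-m_2)})_{12}$ and $(F_1)_{21}=(A_1^{(m_2-m_1)})_{21}$. Moreover, in each of the following two cases, the eigenvalues of $F(\varepsilon)$ (the Floquet exponents) in some fixed disc around $f_0$ are, counted with multiplicity, for all small $|\varepsilon|$ exactly two numbers $$f_{1,2}(\varepsilon)=f_0\pm\varepsilon\sqrt{(F_1)_{12}(F_1)_{21}}+O(\varepsilon^2),$$ for either choice of the square root, and hence the gap between them is $f_1-f_2=2\varepsilon\sqrt{(F_1)_{12}(F_1)_{21}}+O(\varepsilon^2)$: (a) The system is the capacitance system of a periodic chain of $N$ resonators, with $n=2N$: in a fixed basis of $\mathbb C^{2N}$ (in which the static matrix is diagonal), $A$ is $\begin{pmatrix}0&I\\-M&0\end{pmatrix}$, $M=\frac{\delta\kappa_r}{\rho_r}W_1C^\alpha W_2+W_3$, where $\delta,\kappa_r,\rho_r>0$, $\alpha\in\mathbb R$, the $W_k$ are diagonal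 with $(W_1)_{ii}=\sqrt{\kappa_i}/\ell_i$, $(W_2)_{ii}=\sqrt{\kappa_i}$, $(W_3)_{ii}=\frac{\sqrt{\kappa_i}}2\frac{d}{dt}\frac{\kappa_i'}{\kappa_i^{3/2}}$, the moduli $\kappa_i(\varepsilon,t)>0$ are $T$-periodic and $C^2$ in $t$, and $\ell_i$ is the length of the $i$-th resonator. The capacitance matrix $C^\alpha$ is the sum of the following contributions of the gaps, $g_i>0$ being the length of the gap following the $i$-th resonator and $L$ the spatial period: for $i<N$, gap $i$ contributes $1/g_i$ at $(i,i)$ and $(i+1,i+1)$ and $-1/g_i$ at $(i,i+1)$ and $(i+1,i)$; gap $N$ contributes $1/g_N$ at $(N,N)$ and $(1,1)$, $-e^{\mathrm i\alpha L}/g_N$ at $(N,1)$ and $-e^{-\mathrm i\alpha L}/g_N$ at $(1,N)$. (b) $A$ is arbitrary as above, and $(F_1)_{12}$ and $(F_1)_{21}$ are either both zero or both nonzero. -/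

import Mathlib

open Filter Topology Asymptotics

noncomputable section

/-- The folding number of the frequency `ω`: the unique integer `m` with
`ω - m Ω ∈ [-Ω/2, Ω/2)`, see `foldingNumber_spec`. -/
def foldingNumber (Ω ω : ℝ) : ℤ := ⌊ω / Ω + 1 / 2⌋

theorem foldingNumber_spec {Ω : ℝ} (hΩ : 0 < Ω) (ω : ℝ) (m : ℤ) :
    ω - m * Ω ∈ Set.Ico (-(Ω / 2)) (Ω / 2) ↔ m = foldingNumber Ω ω := by
  have h : ω = ω / Ω * Ω := by field_simp
  rw [foldingNumber, eq_comm, Int.floor_eq_iff, Set.mem_Ico]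
  constructor
  · rintro ⟨h1, h2⟩
    constructor
    · by_contra hc
      push Not at hc
      nlinarith
    · by_contra hc
      push Not at hc
      nlinarith
  · rintro ⟨h1, h2⟩
    constructor <;> nlinarith

/-- The `m`-th Fourier coefficient of a function of period `2π/Ω`, with values in the matrices:
`G^(m) = (Ω/2π) ∫_0^{2π/Ω} G(t) e^{-iΩmt} dt`. -/
def matrixFourierCoeff {ι : Type*} (Ω : ℝ) (G : ℝ → Matrix ι ι ℂ) (m : ℤ) : Matrix ι ι ℂ :=
  Matrix.of fun i j =>
    ((Ω / (2 * Real.pi) : ℝ) : ℂ) *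
      ∫ t in (0 : ℝ)..(2 * Real.pi / Ω),
        G t i j * Complex.exp (-(Complex.I * ((Ω * m * t : ℝ) : ℂ)))

/-- The coefficient `A(ε,t)` of the system `y' = A(ε,t) y` is given, for `|ε| < ε₀`, by the power
series `A₀ + ε A₁(t) + ε² A₂(t) + ⋯`, whose coefficients are continuous and periodic in `t` with
period `2π/Ω`, which converges normally with respect to `t`, and whose leading coefficient is the
constant diagonal matrix `A₀ = diag(d)`. -/
structure IsModulatedSystem {ι : Type*} [DecidableEq ι] (Ω ε₀ : ℝ)
    (A : ℝ → ℝ → Matrix ι ι ℂ) (Ac : ℕ → ℝ → Matrix ι ι ℂ) (d : ι → ℂ) : Prop where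
  periodic : ∀ n, Function.Periodic (Ac n) (2 * Real.pi / Ω)
  continuous : ∀ n i j, Continuous fun t => Ac n t i j
  normal : ∃ c : ℕ → ℝ, (∀ n t i j, ‖Ac n t i j‖ ≤ c n) ∧
    ∀ ε : ℝ, |ε| < ε₀ → Summable fun n => c n * |ε| ^ n
  hasSum : ∀ ε : ℝ, |ε| < ε₀ → ∀ t i j,
    HasSum (fun n => (ε : ℂ) ^ n * Ac n t i j) (A ε t i j)
  static : ∀ t, Ac 0 t = Matrix.diagonal d

/-- The diagonal entries of `F₀ = A₀ - iΩ diag(m)`, where `A₀ = diag(d)` and `m j` is the folding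
number of `Im (d j)`. -/
def foldedEntry {ι : Type*} (Ω : ℝ) (d : ι → ℂ) (j : ι) : ℂ :=
  d j - Complex.I * ((Ω * foldingNumber Ω (d j).im : ℝ) : ℂ)

/-- `X(ε,t) = P(ε,t) exp(t F(ε))` is, for all small `ε`, the fundamental solution of
`y' = A(ε,t) y` normalized by `X(ε,0) = 1`; `P(ε,·)` is periodic, `P` and `F` are analytic in `ε`
at `ε = 0`, and `F(0)` is the diagonal matrix `F₀` of the folded entries. -/
structure IsFloquetForm {ι : Type*} [Fintype ι] [DecidableEq ι] (Ω : ℝ)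
    (A : ℝ → ℝ → Matrix ι ι ℂ) (d : ι → ℂ)
    (P : ℝ → ℝ → Matrix ι ι ℂ) (F : ℝ → Matrix ι ι ℂ) : Prop where
  fundamental : ∀ᶠ ε in 𝓝 (0 : ℝ), ∀ t i j,
    HasDerivAt (fun s : ℝ => (P ε s * NormedSpace.exp ((s : ℂ) • F ε)) i j)
      ((A ε t * (P ε t * NormedSpace.exp ((t : ℂ) • F ε))) i j) t
  initial : ∀ᶠ ε in 𝓝 (0 : ℝ), P ε 0 = 1
  periodic : ∀ᶠ ε in 𝓝 (0 : ℝ), Function.Periodic (P ε) (2 * Real.pi / Ω)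
  analytic_P : ∀ t i j, AnalyticAt ℝ (fun ε => P ε t i j) 0
  analytic_F : ∀ i j, AnalyticAt ℝ (fun ε => F ε i j) 0
  zero : F 0 = Matrix.diagonal (foldedEntry Ω d)

/-- The first order coefficient `F₁` in `F(ε) = F₀ + ε F₁ + ⋯`. -/
def firstCoeff {ι : Type*} (F : ℝ → Matrix ι ι ℂ) : Matrix ι ι ℂ :=
  Matrix.of fun i j => deriv (fun ε => F ε i j) 0

/-- The eigenvalues of `F(ε)` associated with `f₀`, i.e. those in a fixed disc around `f₀`, counted
with algebraic multiplicity, are two numbers `f₀ ± ε s + O(ε²)`; so their distance is governed by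
`2 ε s`. -/
def HasSplitting {ι : Type*} [Fintype ι] [DecidableEq ι] (F : ℝ → Matrix ι ι ℂ) (f₀ s : ℂ) :
    Prop :=
  ∃ r : ℝ, 0 < r ∧ ∃ f₁ f₂ : ℝ → ℂ,
    (∀ᶠ ε in 𝓝 (0 : ℝ),
      (open Classical in (F ε).charpoly.roots.filter fun z => dist z f₀ < r) = {f₁ ε, f₂ ε}) ∧
    (fun ε : ℝ => f₁ ε - (f₀ + ε * s)) =O[𝓝 0] (fun ε : ℝ => ε ^ 2) ∧
    (fun ε : ℝ => f₂ ε - (f₀ - ε * s)) =O[𝓝 0] (fun ε : ℝ => ε ^ 2) ∧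
    (fun ε : ℝ => (f₁ ε - f₂ ε) - 2 * ε * s) =O[𝓝 0] (fun ε : ℝ => ε ^ 2)

/-- A chain of `N` disjoint resonators `(left i, right i)`, repeated with period `period`. -/
structure ResonatorChain (N : ℕ) where
  left : Fin N → ℝ
  right : Fin N → ℝ
  period : ℝ
  period_pos : 0 < period
  left_lt_right : ∀ i, left i < right i
  right_lt_left : ∀ i j, i < j → right i < left j
  right_lt_left_add : ∀ i j, right i < left j + period

namespace ResonatorChain

variable {N : ℕ} (D : ResonatorChain N)

/-- The length of the `i`-th resonator. -/
def length (i : Fin N) : ℝ := D.right i - D.left i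

/-- The length of the gap between the `i`-th resonator and the next one; the resonator after
the last one is the first one shifted by one period. -/
def gap (i : Fin N) : ℝ :=
  D.left (finRotate N i) + (if i.val + 1 = N then D.period else 0) - D.right i

/-- The Bloch phase picked up in passing from the `i`-th resonator to the next one. -/
def phase (α : ℝ) (i : Fin N) : ℂ :=
  if i.val + 1 = N then Complex.exp (Complex.I * ((α * D.period : ℝ) : ℂ)) else 1

/-- The quasiperiodic capacitance matrix `C^α`: cyclically tridiagonal, with the reciprocals of the
gap lengths as entries and the phases `e^{∓iαL}` in the corners `(1,N)` and `(N,1)`. For `N ≤ 2`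
the contributions of the coinciding positions add up. -/
def capacitance (α : ℝ) : Matrix (Fin N) (Fin N) ℂ := Matrix.of fun i j =>
  (if i = j then (((D.gap ((finRotate N).symm i))⁻¹ + (D.gap i)⁻¹ : ℝ) : ℂ) else 0)
    - (if j = finRotate N i then D.phase α i * (((D.gap i)⁻¹ : ℝ) : ℂ) else 0)
    - (if i = finRotate N j then
        (starRingEnd ℂ) (D.phase α j) * (((D.gap j)⁻¹ : ℝ) : ℂ) else 0)

/-- The matrix `M^α(t) = (δ κ_r / ρ_r) W₁(t) C^α W₂(t) + W₃(t)` of the second order system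
`Ψ'' + M^α(t) Ψ = 0` for the modulated bulk moduli `κ i t`. -/
def secondOrderMatrix (α δ κr ρr : ℝ) (κ : Fin N → ℝ → ℝ) (t : ℝ) :
    Matrix (Fin N) (Fin N) ℂ :=
  ((δ * κr / ρr : ℝ) : ℂ) •
      (Matrix.diagonal (fun i => ((√(κ i t) / D.length i : ℝ) : ℂ)) * D.capacitance α *
        Matrix.diagonal (fun i => ((√(κ i t) : ℝ) : ℂ)))
    + Matrix.diagonal (fun i =>
        ((√(κ i t) / 2 * deriv (fun s => deriv (κ i) s / (κ i s) ^ (3 / 2 : ℝ)) t : ℝ) : ℂ))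

/-- The coefficient matrix of the first order system equivalent to `Ψ'' + M^α(t) Ψ = 0`. -/
def firstOrderMatrix (α δ κr ρr : ℝ) (κ : Fin N → ℝ → ℝ) (t : ℝ) :
    Matrix (Fin N ⊕ Fin N) (Fin N ⊕ Fin N) ℂ :=
  Matrix.fromBlocks 0 1 (-(D.secondOrderMatrix α δ κr ρr κ t)) 0

end ResonatorChain

/-- For `|ε| < ε₀`, `A(ε,t)` is the coefficient matrix of the capacitance system of a chain of
resonators with positive, periodic, twice continuously differentiable moduli `κ ε i`, written in
a fixed basis of `ℂ^{2N}` (the columns of `S`). -/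
def IsResonatorSystem {ι : Type*} [Fintype ι] [DecidableEq ι] (Ω ε₀ : ℝ)
    (A : ℝ → ℝ → Matrix ι ι ℂ) : Prop :=
  ∃ (N : ℕ) (D : ResonatorChain N) (α δ κr ρr : ℝ) (κ : ℝ → Fin N → ℝ → ℝ)
    (S : Matrix (Fin N ⊕ Fin N) ι ℂ) (S' : Matrix ι (Fin N ⊕ Fin N) ℂ),
    0 < δ ∧ 0 < κr ∧ 0 < ρr ∧ S * S' = 1 ∧ S' * S = 1 ∧
    ∀ ε : ℝ, |ε| < ε₀ →
      (∀ i, (∀ t, 0 < κ ε i t) ∧ ContDiff ℝ 2 (κ ε i) ∧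
        Function.Periodic (κ ε i) (2 * Real.pi / Ω)) ∧
      ∀ t, A ε t = S' * D.firstOrderMatrix α δ κr ρr (κ ε) t * S

end

/-! In the interaction picture `Y = e^{-tA₀} X` the coefficient has no term of order zero. Its Dyson
series converges for small `ε`, so the monodromy matrix `X(ε,T)` is analytic in `ε` and equals
`exp(T F₀)` at `ε = 0`. Folding puts the imaginary parts of the entries of `F₀` into a half-open
interval of length `Ω = 2π/T`. Hence distinct eigenvalues of `T F₀` have distinct exponentials, and
the derivative of `exp` there, given by divided differences, is injective
(`fderiv_exp_diagonal_injective`). A local analytic logarithm of `X(ε,T)` gives `F`, and `P = X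
e^{-tF}`.

Conversely, every representation satisfies `exp(T F(ε)) = X(ε,T)`. Differentiating at `ε = 0`, at a
position `(i,j)` with equal folded entries, gives `T (F₁)ᵢⱼ = ∫ e^{-(dᵢ-dⱼ)s} (A₁)ᵢⱼ ds`. Since `dᵢ
- dⱼ = iΩ(mᵢ-mⱼ)`, this is a Fourier coefficient (`IsFloquetForm.firstCoeff_eq`). In particular the
diagonal of `F₁` vanishes.

For the eigenvalues, `F(ε)` is brought analytically to block triangular form, with a `2 × 2` block
that agrees with that of `F(ε)` up to `O(ε²)` (`hasSplitting_of_analytic`). Half the difference of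
its two roots is a square root of `ε²s² + O(ε³)`. This gives `±εs + O(ε²)` if `s ≠ 0`, and also if
both off-diagonal entries of `F₁` vanish. If exactly one of them vanished, the argument would only
give `O(|ε|^{3/2})`.

This last possibility cannot occur for resonators. The capacitance system preserves a skew-Hermitian
form `J`, because `diag(ℓ) M` is Hermitian. If the static `M` is independent of time, then `diag(ℓ)
M` is even positive semidefinite, although the static moduli need not be constant. Together with
diagonalizability this makes every `dⱼ` imaginary and nonzero and gives `Jⱼⱼ ≠ 0`
(`IsResonatorSystem.exists_form`). Invariance of `J` to first order in `ε` ties `(A₁)₁₂` to the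
conjugate of `(A₁)₂₁` with nonzero factors, so the two Fourier coefficients vanish together. -/

/-! ### Power series in a parameter and the analytic inverse function theorem -/

section AnalyticTools

theorem hasFPowerSeriesAt_of_hasSum_pow_smul {E : Type*} [NormedAddCommGroup E] [NormedSpace ℝ E]
    {f : ℝ → E} {a : ℕ → E}
    (h : ∀ᶠ ε in 𝓝 (0 : ℝ), HasSum (fun n => ε ^ n • a n) (f ε)) :
    HasFPowerSeriesAt f (fun n => ContinuousMultilinearMap.mkPiRing ℝ (Fin n) (a n) :
      FormalMultilinearSeries ℝ ℝ E) 0 := by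
  refine hasFPowerSeriesAt_iff.2 ?_
  filter_upwards [h] with ε hε
  simpa [FormalMultilinearSeries.coeff] using hε

theorem hasDerivAt_of_hasSum_pow_smul {E : Type*} [NormedAddCommGroup E] [NormedSpace ℝ E]
    {f : ℝ → E} {a : ℕ → E}
    (h : ∀ᶠ ε in 𝓝 (0 : ℝ), HasSum (fun n => ε ^ n • a n) (f ε)) : HasDerivAt f (a 1) 0 := by
  simpa using (hasFPowerSeriesAt_of_hasSum_pow_smul h).hasDerivAt

theorem AnalyticAt.isBigO_sub_deriv {E : Type*} [NormedAddCommGroup E] [NormedSpace ℝ E]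
    {f : ℝ → E} (h : AnalyticAt ℝ f 0) :
    (fun ε => f ε - (f 0 + ε • deriv f 0)) =O[𝓝 0] fun ε : ℝ => ε ^ 2 := by
  obtain ⟨s, hs⟩ := h
  have h1 := hs.isBigO_sub_partialSum_pow 2
  have h2 : deriv f 0 = s.coeff 1 := by
    rw [hs.hasDerivAt.deriv]
    rfl
  have h3 : f 0 = s.coeff 0 := by
    rw [FormalMultilinearSeries.coeff, hs.coeff_zero]
  refine (h1.congr (fun ε => ?_) (fun ε => rfl)).trans (IsBigO.of_norm_left ?_)
  · rw [zero_add, h2, h3]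
    simp [FormalMultilinearSeries.partialSum, Finset.sum_range_succ]
  · simpa using isBigO_refl (fun ε : ℝ => ε ^ 2) (𝓝 0)

/-- The chain rule as a device for computation: the derivative in a direction can be read off any
curve with that tangent, so a curve can be chosen along which `f` is explicit. -/
theorem DifferentiableAt.fderiv_apply_eq_of_curve {E : Type*} [NormedAddCommGroup E]
    [NormedSpace ℂ E] {f : E → E} {a h e : E} (hf : DifferentiableAt ℂ f a) {c : ℂ → E}
    (hc0 : c 0 = a) (hc : HasDerivAt c h 0) (he : HasDerivAt (fun s => f (c s)) e 0) :
    fderiv ℂ f a h = e := by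
  have h2 := hf.hasFDerivAt
  rw [← hc0] at h2
  have h3 := h2.comp_hasDerivAt (0 : ℂ) hc
  rw [hc0] at h3
  exact h3.unique he

/-- An analytic map of a finite dimensional space with injective derivative has an analytic local
inverse. -/
theorem AnalyticAt.exists_local_inverse {E : Type*} [NormedAddCommGroup E] [NormedSpace ℂ E]
    [FiniteDimensional ℂ E] {f : E → E} {a : E} (hf : AnalyticAt ℂ f a)
    (hinj : Function.Injective (fderiv ℂ f a)) :
    ∃ g : E → E, AnalyticAt ℂ g (f a) ∧ g (f a) = a ∧ (∀ᶠ x in 𝓝 a, g (f x) = x) ∧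
      ∀ᶠ y in 𝓝 (f a), f (g y) = y := by
  have : CompleteSpace E := FiniteDimensional.complete ℂ E
  let f' : E ≃L[ℂ] E :=
    (LinearEquiv.ofInjectiveEndo (fderiv ℂ f a : E →ₗ[ℂ] E) hinj).toContinuousLinearEquiv
  have h' : (f' : E →L[ℂ] E) = fderiv ℂ f a := by
    ext x
    rfl
  have hd : HasFDerivAt f (f' : E →L[ℂ] E) a := h' ▸ hf.differentiableAt.hasFDerivAt
  -- The order `⊤` includes analyticity, so the smooth inverse function theorem returns an analytic
  -- inverse.
  have hc : ContDiffAt ℂ ⊤ f a := hf.contDiffAt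
  have hs : HasStrictFDerivAt f (f' : E →L[ℂ] E) a := hc.hasStrictFDerivAt' hd (by simp)
  refine ⟨hs.localInverse f f' a, ?_, hs.localInverse_apply_image,
    hs.eventually_left_inverse, hs.eventually_right_inverse⟩
  exact (hc.to_localInverse hd (by simp)).analyticAt

end AnalyticTools

/-! ### The derivative of the matrix exponential at a diagonal matrix -/

section ExpDerivative

section

variable {𝔸 : Type*} [NormedRing 𝔸] [NormedAlgebra ℂ 𝔸] [CompleteSpace 𝔸]

theorem hasDerivAt_exp_smul_zero (G : 𝔸) :
    HasDerivAt (fun s : ℂ => NormedSpace.exp (s • G)) G 0 := by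
  simpa using hasDerivAt_exp_smul_const (𝕂 := ℂ) G (0 : ℂ)

theorem fderiv_exp_apply_of_commute {D H : 𝔸} (h : Commute D H) :
    fderiv ℂ NormedSpace.exp D H = NormedSpace.exp D * H := by
  let _ : NormedAlgebra ℚ 𝔸 := NormedAlgebra.restrictScalars ℚ ℂ 𝔸
  refine (NormedSpace.exp_analytic (𝕂 := ℂ) D).differentiableAt.fderiv_apply_eq_of_curve
    (c := fun s => D + s • H) (by simp) ?_ ?_
  · have := ((hasDerivAt_id (0 : ℂ)).smul_const H).const_add D
    rwa [one_smul] at this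
  · have : (fun s : ℂ => NormedSpace.exp (D + s • H)) =
        fun s => NormedSpace.exp D * NormedSpace.exp (s • H) := by
      funext s
      exact NormedSpace.exp_add_of_commute (h.smul_right s)
    rw [this]
    exact (hasDerivAt_exp_smul_zero H).const_mul _

/-- The curve `e^{-sG} D e^{sG}` has tangent `DG - GD` at `s = 0`, and `exp` commutes with
conjugation. -/
theorem fderiv_exp_apply_commutator (D G : 𝔸) :
    fderiv ℂ NormedSpace.exp D (D * G - G * D) =
      NormedSpace.exp D * G - G * NormedSpace.exp D := by
  let _ : NormedAlgebra ℚ 𝔸 := NormedAlgebra.restrictScalars ℚ ℂ 𝔸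
  have hconj (M : 𝔸) : HasDerivAt
      (fun s : ℂ => NormedSpace.exp (s • (-G)) * M * NormedSpace.exp (s • G))
      (M * G - G * M) 0 := by
    have := ((hasDerivAt_exp_smul_zero (-G)).mul_const M).mul (hasDerivAt_exp_smul_zero G)
    refine this.congr_deriv ?_
    rw [zero_smul, zero_smul, NormedSpace.exp_zero, mul_one, one_mul, neg_mul]
    abel
  refine (NormedSpace.exp_analytic (𝕂 := ℂ) D).differentiableAt.fderiv_apply_eq_of_curve
    (by simp) (hconj D) ?_
  refine (hconj (NormedSpace.exp D)).congr_of_eventuallyEq (Eventually.of_forall fun s => ?_)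
  have hinv : NormedSpace.exp (s • (-G)) * NormedSpace.exp (s • G) = 1 ∧
      NormedSpace.exp (s • G) * NormedSpace.exp (s • (-G)) = 1 := by
    constructor <;> rw [← NormedSpace.exp_add_of_commute]
    · simp
    · simp [Commute, SemiconjBy]
    · simp
    · simp [Commute, SemiconjBy]
  exact NormedSpace.exp_units_conj ⟨_, _, hinv.1, hinv.2⟩ D

end

open scoped Matrix.Norms.Operator

variable {ι : Type*} [Fintype ι] [DecidableEq ι]

theorem Matrix.exp_diagonal_complex (v : ι → ℂ) :
    NormedSpace.exp (Matrix.diagonal v) = Matrix.diagonal fun i => Complex.exp (v i) := by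
  rw [Matrix.exp_diagonal, Complex.exp_eq_exp_ℂ]
  congr 1
  exact Pi.exp_def v

/-- Every direction splits into a part commuting with `D` (the entries with `v i = v j`) and a
commutator `DG - GD`, where `G` divides the other entries by `v i - v j`. The two preceding lemmas
treat these parts. -/
theorem fderiv_exp_diagonal_apply (v : ι → ℂ) (H : Matrix ι ι ℂ) (i j : ι) :
    fderiv ℂ NormedSpace.exp (Matrix.diagonal v) H i j =
      if v i = v j then Complex.exp (v i) * H i j
      else (Complex.exp (v i) - Complex.exp (v j)) / (v i - v j) * H i j := by
  set D := Matrix.diagonal v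
  let H' : Matrix ι ι ℂ := Matrix.of fun i j => if v i = v j then H i j else 0
  let G : Matrix ι ι ℂ := Matrix.of fun i j => H i j / (v i - v j)
  have hH : H = H' + (D * G - G * D) := by
    ext i j
    simp only [D, H', G, Matrix.add_apply, Matrix.sub_apply, Matrix.diagonal_mul,
      Matrix.mul_diagonal, Matrix.of_apply]
    split_ifs with h
    · simp [h]
    · have : v i - v j ≠ 0 := sub_ne_zero.2 h
      field_simp
      ring
  have hcomm : Commute D H' := by
    ext i j
    simp only [D, H', Matrix.diagonal_mul, Matrix.mul_diagonal, Matrix.of_apply]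
    split_ifs with h
    · rw [h, mul_comm]
    · simp
  have hexp := Matrix.exp_diagonal_complex v
  have hL : fderiv ℂ NormedSpace.exp D H = NormedSpace.exp D * H' +
      (NormedSpace.exp D * G - G * NormedSpace.exp D) := by
    conv_lhs => rw [hH]
    exact (map_add _ _ _).trans
      (congrArg₂ _ (fderiv_exp_apply_of_commute hcomm) (fderiv_exp_apply_commutator D G))
  rw [show NormedSpace.exp D = _ from hexp] at hL
  refine (congrFun (congrFun hL i) j).trans ?_
  simp only [H', G, Matrix.add_apply, Matrix.sub_apply, Matrix.diagonal_mul,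
      Matrix.mul_diagonal, Matrix.of_apply]
  split_ifs with h
  · simp [h]
  · ring

theorem fderiv_exp_diagonal_injective {v : ι → ℂ}
    (hv : ∀ i j, Complex.exp (v i) = Complex.exp (v j) → v i = v j) :
    Function.Injective (fderiv ℂ (NormedSpace.exp : Matrix ι ι ℂ → _) (Matrix.diagonal v)) := by
  refine (injective_iff_map_eq_zero _).2 fun H hH => ?_
  ext i j
  have := (fderiv_exp_diagonal_apply v H i j).symm.trans (congrFun (congrFun hH i) j)
  split_ifs at this with h
  · simpa [Complex.exp_ne_zero] using this
  · have h1 : Complex.exp (v i) - Complex.exp (v j) ≠ 0 := fun h' => h (hv i j (sub_eq_zero.1 h'))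
    have h2 : v i - v j ≠ 0 := sub_ne_zero.2 h
    simpa [h1, h2] using this

end ExpDerivative

/-! ### Dyson series: majorants, convergence and the differential equation -/

section Dyson

/-- One step of the majorant induction. With weights `ρ⁻¹ ^ j` on `Y j`, the convolution becomes
`ρ⁻¹ ^ (k + 1)` times a partial sum of the majorant series of `B` at `ρ`. The exponent is `k + 1`
because `B k` is the coefficient of `ε ^ (k + 1)`. -/
theorem norm_sum_range_mul_le {𝔸 : Type*} [NormedRing 𝔸] {B : ℕ → ℝ → 𝔸} {c : ℕ → ℝ}
    {ρ R : ℝ} (hρ : 0 < ρ)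
    (hc : ∀ k t, |t| ≤ R → ‖B k t‖ ≤ c k) (hs : Summable fun k => c k * ρ ^ (k + 1))
    {k : ℕ} {t : ℝ} (ht : |t| ≤ R) {Y : ℕ → 𝔸} {b : ℝ} (hb : 0 ≤ b)
    (hY : ∀ j ≤ k, ‖Y j‖ ≤ ρ⁻¹ ^ j * b) :
    ‖∑ j ∈ Finset.range (k + 1), B (k - j) t * Y j‖ ≤
      ρ⁻¹ ^ (k + 1) * ((∑' k, c k * ρ ^ (k + 1)) * b) := by
  have hc0 : ∀ k, 0 ≤ c k := fun k => (norm_nonneg _).trans (hc k t ht)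
  calc ‖∑ j ∈ Finset.range (k + 1), B (k - j) t * Y j‖
      ≤ ∑ j ∈ Finset.range (k + 1), c (k - j) * (ρ⁻¹ ^ j * b) := by
        refine norm_sum_le_of_le _ fun j hj => (norm_mul_le _ _).trans ?_
        exact mul_le_mul (hc _ _ ht) (hY j (Nat.lt_succ_iff.1 (Finset.mem_range.1 hj)))
          (norm_nonneg _) (hc0 _)
    _ = ∑ j ∈ Finset.range (k + 1), ρ⁻¹ ^ (k + 1) * b * (c (k - j) * ρ ^ (k - j + 1)) := by
        refine Finset.sum_congr rfl fun j hj => ?_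
        have hj' : j ≤ k := Nat.lt_succ_iff.1 (Finset.mem_range.1 hj)
        have : k + 1 = j + (k - j + 1) := by omega
        rw [this, pow_add]
        have h1 : ρ⁻¹ ^ (k - j + 1) * ρ ^ (k - j + 1) = 1 := by
          rw [← mul_pow, inv_mul_cancel₀ hρ.ne', one_pow]
        linear_combination (-(c (k - j) * ρ⁻¹ ^ j * b)) * h1
    _ = ρ⁻¹ ^ (k + 1) * b * ∑ j ∈ Finset.range (k + 1), c j * ρ ^ (j + 1) := by
        rw [← Finset.mul_sum]
        congr 1
        have := Finset.sum_range_reflect (fun j => c j * ρ ^ (j + 1)) (k + 1)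
        rw [← this]
        refine Finset.sum_congr rfl fun j hj => ?_
        rw [show k + 1 - 1 - j = k - j by omega]
    _ ≤ ρ⁻¹ ^ (k + 1) * b * ∑' k, c k * ρ ^ (k + 1) := by
        refine mul_le_mul_of_nonneg_left (hs.sum_le_tsum _ fun j _ => ?_) (by positivity)
        exact mul_nonneg (hc0 j) (by positivity)
    _ = _ := by ring

variable {𝔸 : Type*} [NormedRing 𝔸] [NormedAlgebra ℝ 𝔸]

/-- The coefficients of the solution `Y(ε,t) = ∑ ε^k Y_k(t)` of
`Y' = (ε B₀ + ε² B₁ + ⋯) Y`, `Y(ε,0) = 1`. -/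
noncomputable def dysonTerm (B : ℕ → ℝ → 𝔸) : ℕ → ℝ → 𝔸
  | 0 => fun _ => 1
  | k + 1 => fun t => ∫ s in (0 : ℝ)..t, ∑ j : Fin (k + 1), B (k - j) s * dysonTerm B j s

theorem dysonTerm_zero (B : ℕ → ℝ → 𝔸) (t : ℝ) : dysonTerm B 0 t = 1 := by
  rw [dysonTerm]

theorem dysonTerm_succ (B : ℕ → ℝ → 𝔸) (k : ℕ) (t : ℝ) :
    dysonTerm B (k + 1) t =
      ∫ s in (0 : ℝ)..t, ∑ j ∈ Finset.range (k + 1), B (k - j) s * dysonTerm B j s := by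
  rw [dysonTerm]
  simp only [Finset.sum_range]

theorem continuous_dysonTerm {B : ℕ → ℝ → 𝔸} (hB : ∀ k, Continuous (B k)) (k : ℕ) :
    Continuous (dysonTerm B k) := by
  induction k using Nat.strong_induction_on with
  | _ k ih =>
    rcases k with _ | k
    · rw [funext (dysonTerm_zero B)]
      exact continuous_const
    · rw [funext (dysonTerm_succ B k)]
      refine intervalIntegral.continuous_primitive (fun a b => ?_) 0
      refine Continuous.intervalIntegrable (continuous_finsetSum _ fun j hj => ?_) a b
      exact (hB _).mul (ih j (Finset.mem_range.1 hj))

theorem hasDerivAt_dysonTerm_succ [CompleteSpace 𝔸] {B : ℕ → ℝ → 𝔸} (hB : ∀ k, Continuous (B k))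
    (k : ℕ) (t : ℝ) : HasDerivAt (dysonTerm B (k + 1))
      (∑ j ∈ Finset.range (k + 1), B (k - j) t * dysonTerm B j t) t := by
  have hc : Continuous fun s => ∑ j ∈ Finset.range (k + 1), B (k - j) s * dysonTerm B j s :=
    continuous_finsetSum _ fun j _ => (hB _).mul (continuous_dysonTerm hB j)
  rw [funext (dysonTerm_succ B k)]
  exact intervalIntegral.integral_hasDerivAt_right (hc.intervalIntegrable 0 t)
    (hc.stronglyMeasurableAtFilter _ _) hc.continuousAt

theorem dysonTerm_succ_zero (B : ℕ → ℝ → 𝔸) (k : ℕ) : dysonTerm B (k + 1) 0 = 0 := by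
  rw [dysonTerm_succ, intervalIntegral.integral_same]

theorem abs_integral_mul_cosh_le (K t : ℝ) :
    |∫ s in (0 : ℝ)..t, K * Real.cosh (K * s)| ≤ Real.cosh (K * t) := by
  have h1 : ∀ s : ℝ, HasDerivAt (fun s => Real.sinh (K * s)) (K * Real.cosh (K * s)) s := by
    intro s
    simpa [mul_comm] using ((hasDerivAt_id s).const_mul K).sinh
  rw [intervalIntegral.integral_eq_sub_of_hasDerivAt (fun s _ => h1 s)
    (Continuous.intervalIntegrable (by fun_prop) _ _)]
  simp only [mul_zero, Real.sinh_zero, sub_zero]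
  rw [← Real.cosh_abs, ← abs_of_nonneg (Real.cosh_pos _).le]
  rw [Real.abs_sinh, Real.cosh_abs, abs_of_pos (Real.cosh_pos _), ← Real.cosh_abs]
  exact (Real.sinh_lt_cosh _).le

variable {B : ℕ → ℝ → 𝔸} {c : ℕ → ℝ} {ρ R : ℝ}

/-- The majorant `cosh (K t)` reproduces itself under integration, since the primitive of `K cosh (K
s)` is `sinh (K t)`, which is at most `cosh (K t)` in absolute value. Being even, it serves both
signs of `t`. -/
theorem norm_dysonTerm_le (hρ : 0 < ρ)
    (hc : ∀ k t, |t| ≤ R → ‖B k t‖ ≤ c k) (hs : Summable fun k => c k * ρ ^ (k + 1))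
    (k : ℕ) (t : ℝ) (ht : |t| ≤ R) :
    ‖dysonTerm B k t‖ ≤
      ρ⁻¹ ^ k * (Real.cosh ((∑' k, c k * ρ ^ (k + 1)) * t) * ‖(1 : 𝔸)‖) := by
  set K := ∑' k, c k * ρ ^ (k + 1) with hKdef
  induction k using Nat.strong_induction_on generalizing t with
  | _ k ih =>
    rcases k with _ | k
    · rw [dysonTerm_zero, pow_zero, one_mul]
      exact le_mul_of_one_le_left (norm_nonneg _) (Real.one_le_cosh _)
    · rw [dysonTerm_succ]
      have hle : ∀ s ∈ Set.uIoc 0 t,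
          ‖∑ j ∈ Finset.range (k + 1), B (k - j) s * dysonTerm B j s‖ ≤
            ρ⁻¹ ^ (k + 1) * ‖(1 : 𝔸)‖ * (K * Real.cosh (K * s)) := by
        intro s hs'
        have hsR : |s| ≤ R := by
          refine le_trans ?_ ht
          have := Set.uIoc_subset_uIcc hs'
          simpa using Set.abs_sub_left_of_mem_uIcc this
        refine (norm_sum_range_mul_le hρ hc hs hsR (by positivity) fun j hj =>
          ih j (Nat.lt_succ_of_le hj) s hsR).trans (le_of_eq ?_)
        ring
      have hint : IntervalIntegrable
          (fun s => ρ⁻¹ ^ (k + 1) * ‖(1 : 𝔸)‖ * (K * Real.cosh (K * s))) MeasureTheory.volume 0 t :=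
        Continuous.intervalIntegrable (by fun_prop) _ _
      refine (intervalIntegral.norm_integral_le_abs_of_norm_le
        (MeasureTheory.ae_restrict_of_forall_mem measurableSet_uIoc hle) hint).trans ?_
      rw [intervalIntegral.integral_const_mul, abs_mul,
        abs_of_nonneg (by positivity : 0 ≤ ρ⁻¹ ^ (k + 1) * ‖(1 : 𝔸)‖)]
      refine (mul_le_mul_of_nonneg_left (abs_integral_mul_cosh_le K t)
        (by positivity)).trans (le_of_eq (by ring))

end Dyson

/-- The solution `Y(ε,t)` of `Y' = (ε B₀ + ε² B₁ + ⋯) Y`, `Y(ε,0) = 1`. -/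
noncomputable def dysonSeries {𝔸 : Type*} [NormedRing 𝔸] [NormedAlgebra ℝ 𝔸]
    (B : ℕ → ℝ → 𝔸) (ε t : ℝ) : 𝔸 := ∑' k, ε ^ k • dysonTerm B k t

section DysonSeries

variable {𝔸 : Type*} [NormedRing 𝔸] [NormedAlgebra ℝ 𝔸]
  {B : ℕ → ℝ → 𝔸} {ρ ε : ℝ}

theorem abs_mul_inv_lt_one (hρ : 0 < ρ) (hε : |ε| < ρ) : |ε| * ρ⁻¹ < 1 := by
  rw [← div_eq_mul_inv, div_lt_one hρ]
  exact hε

theorem dysonSeries_zero (B : ℕ → ℝ → 𝔸) (ε : ℝ) : dysonSeries B ε 0 = 1 := by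
  rw [dysonSeries, tsum_eq_single 0]
  · rw [dysonTerm_zero, pow_zero, one_smul]
  · intro k hk
    obtain ⟨k, rfl⟩ := Nat.exists_eq_succ_of_ne_zero hk
    rw [dysonTerm_succ_zero, smul_zero]

theorem summable_norm_dysonTerm (hρ : 0 < ρ)
    (hb : ∀ R : ℝ, ∃ c : ℕ → ℝ, (∀ k t, |t| ≤ R → ‖B k t‖ ≤ c k) ∧
      Summable fun k => c k * ρ ^ (k + 1)) (hε : |ε| < ρ) (t : ℝ) :
    Summable fun k => ‖ε ^ k • dysonTerm B k t‖ := by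
  obtain ⟨c, hc, hs⟩ := hb |t|
  refine Summable.of_nonneg_of_le (fun _ => norm_nonneg _) (fun k => ?_)
    ((summable_geometric_of_lt_one (by positivity) (abs_mul_inv_lt_one hρ hε)).mul_right
      (Real.cosh ((∑' k, c k * ρ ^ (k + 1)) * t) * ‖(1 : 𝔸)‖))
  rw [norm_smul, norm_pow, Real.norm_eq_abs, mul_pow, mul_assoc]
  exact mul_le_mul_of_nonneg_left (norm_dysonTerm_le hρ hc hs k t le_rfl) (by positivity)

theorem hasDerivAt_dysonSeries [CompleteSpace 𝔸] (hB : ∀ k, Continuous (B k)) (hρ : 0 < ρ)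
    (hb : ∀ R : ℝ, ∃ c : ℕ → ℝ, (∀ k t, |t| ≤ R → ‖B k t‖ ≤ c k) ∧
      Summable fun k => c k * ρ ^ (k + 1)) (hε : |ε| < ρ) (t : ℝ) :
    HasDerivAt (dysonSeries B ε)
      ((∑' k, ε ^ (k + 1) • B k t) * dysonSeries B ε t) t := by
  -- Termwise differentiation needs uniform bounds on an open interval around `t`, hence the margin
  -- `1`.
  obtain ⟨c, hc, hs⟩ := hb (|t| + 1)
  set K := ∑' k, c k * ρ ^ (k + 1) with hK
  set R := |t| + 1
  have hc0 : ∀ k, 0 ≤ c k := fun k => (norm_nonneg _).trans (hc k t (by simp [R]))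
  have hK0 : 0 ≤ K := tsum_nonneg fun k => mul_nonneg (hc0 k) (by positivity)
  have hR0 : 0 < R := by positivity
  let g' : ℕ → ℝ → 𝔸 := fun k s => match k with
    | 0 => 0
    | k + 1 => ε ^ (k + 1) • ∑ j ∈ Finset.range (k + 1), B (k - j) s * dysonTerm B j s
  have hgeo := summable_geometric_of_lt_one (by positivity) (abs_mul_inv_lt_one hρ hε)
  have hder : HasDerivAt (fun s => ∑' k, ε ^ k • dysonTerm B k s) (∑' k, g' k t) t := by
    refine hasDerivAt_tsum_of_isPreconnected (t := Set.Ioo (-R) R) (y₀ := t)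
      (hgeo.mul_right (K * (Real.cosh (K * R) * ‖(1 : 𝔸)‖)))
      isOpen_Ioo isPreconnected_Ioo (fun k s _ => ?_) (fun k s hs' => ?_) ?_ ?_ ?_
    · rcases k with _ | k
      · simp only [dysonTerm_zero, g']
        exact hasDerivAt_const _ _
      · exact (hasDerivAt_dysonTerm_succ hB k s).const_smul (ε ^ (k + 1))
    · rcases k with _ | k
      · simp only [g', norm_zero]
        positivity
      · have hsR : |s| ≤ R := (abs_lt.2 hs').le
        have hb' : ∀ j ≤ k, ‖dysonTerm B j s‖ ≤
            ρ⁻¹ ^ j * (Real.cosh (K * R) * ‖(1 : 𝔸)‖) := fun j _ => by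
          refine (norm_dysonTerm_le hρ hc hs j s hsR).trans ?_
          gcongr
          rw [Real.cosh_le_cosh, abs_mul, abs_mul, abs_of_pos hR0]
          gcongr
        simp only [g', norm_smul, norm_pow, Real.norm_eq_abs]
        rw [mul_pow, mul_assoc]
        exact mul_le_mul_of_nonneg_left
          (norm_sum_range_mul_le hρ hc hs hsR (by positivity) hb') (by positivity)
    · exact abs_lt.1 (lt_add_one _)
    · exact (summable_norm_dysonTerm hρ hb hε t).of_norm
    · exact abs_lt.1 (lt_add_one _)
  refine hder.congr_deriv ?_
  have hsB : Summable fun k => ‖ε ^ k • B k t‖ := by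
    refine Summable.of_nonneg_of_le (fun _ => norm_nonneg _) (fun k => ?_) (hs.mul_right ρ⁻¹)
    rw [norm_smul, norm_pow, Real.norm_eq_abs, pow_succ]
    have : c k * (ρ ^ k * ρ) * ρ⁻¹ = ρ ^ k * c k := by field_simp
    rw [this]
    exact mul_le_mul (pow_le_pow_left₀ (abs_nonneg _) hε.le _) (hc _ _ (by simp [R]))
      (norm_nonneg _) (by positivity)
  -- Apart from the zero term at `k = 0`, the termwise derivatives are `ε` times the Cauchy product
  -- of `∑ ε^k B_k` and the Dyson series. Both factors converge absolutely.
  have hsum : Summable fun k => g' k t := by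
    rw [← summable_nat_add_iff 1]
    have := (summable_norm_sum_mul_range_of_summable_norm hsB
      (summable_norm_dysonTerm hρ hb hε t)).of_norm.const_smul ε
    refine this.congr fun k => ?_
    simp only [g']
    rw [← Finset.sum_range_reflect, pow_succ', mul_smul]
    congr 1
    rw [Finset.smul_sum]
    refine Finset.sum_congr rfl fun j hj => ?_
    have hj' := Finset.mem_range.1 hj
    rw [smul_mul_smul_comm, ← pow_add, show k + 1 - 1 - j + (k - (k + 1 - 1 - j)) = k by omega,
      show k - (k + 1 - 1 - j) = j by omega, show k + 1 - 1 - j = k - j by omega]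
  have h1 : (∑' k, ε ^ (k + 1) • B k t) = ε • ∑' k, ε ^ k • B k t := by
    rw [← tsum_const_smul'' ε]
    simp only [pow_succ', mul_smul]
  rw [hsum.tsum_eq_zero_add, h1, smul_mul_assoc, dysonSeries,
    tsum_mul_tsum_eq_tsum_sum_range_of_summable_norm hsB
      (summable_norm_dysonTerm hρ hb hε t), ← tsum_const_smul'' ε]
  simp only [g', zero_add]
  refine tsum_congr fun k => ?_
  rw [← Finset.sum_range_reflect, pow_succ', mul_smul]
  congr 1
  rw [Finset.smul_sum]
  refine Finset.sum_congr rfl fun j hj => ?_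
  have hj' := Finset.mem_range.1 hj
  rw [smul_mul_smul_comm, ← pow_add, show j + (k - j) = k by omega,
      show k - (k + 1 - 1 - j) = j by omega, show k + 1 - 1 - j = k - j by omega]

end DysonSeries

/-! ### Entrywise calculus for matrices -/

section MatrixCalculus

open scoped Matrix.Norms.Operator

variable {ι : Type*} [Fintype ι] [DecidableEq ι]

theorem Matrix.hasDerivAt_iff {X : ℝ → Matrix ι ι ℂ} {X' : Matrix ι ι ℂ} {t : ℝ} :
    HasDerivAt X X' t ↔ ∀ i j, HasDerivAt (fun s => X s i j) (X' i j) t := by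
  constructor
  · intro h i j
    exact ((Matrix.entryLinearMap ℝ ℂ i j).toContinuousLinearMap.hasFDerivAt).comp_hasDerivAt t h
  · intro h
    have h1 : X = fun s => ∑ i, ∑ j, Matrix.single i j (X s i j) :=
      funext fun s => Matrix.matrix_eq_sum_single _
    rw [h1, Matrix.matrix_eq_sum_single X']
    refine HasDerivAt.fun_sum fun i _ => HasDerivAt.fun_sum fun j _ => ?_
    exact ((Matrix.singleLinearMap ℝ i j).toContinuousLinearMap.hasFDerivAt).comp_hasDerivAt t
      (h i j)

theorem Matrix.analyticAt_iff {X : ℝ → Matrix ι ι ℂ} {t : ℝ} :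
    AnalyticAt ℝ X t ↔ ∀ i j, AnalyticAt ℝ (fun s => X s i j) t := by
  constructor
  · intro h i j
    exact ((Matrix.entryLinearMap ℝ ℂ i j).toContinuousLinearMap.analyticAt _).comp h
  · intro h
    have h1 : X = fun s => ∑ i, ∑ j, Matrix.single i j (X s i j) :=
      funext fun s => Matrix.matrix_eq_sum_single _
    rw [h1]
    refine Finset.analyticAt_fun_sum _ fun i _ => Finset.analyticAt_fun_sum _ fun j _ => ?_
    exact ((Matrix.singleLinearMap ℝ i j).toContinuousLinearMap.analyticAt _).comp (h i j)

theorem Matrix.norm_le_card_mul {M : Matrix ι ι ℂ} {c : ℝ} (hc : 0 ≤ c)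
    (h : ∀ i j, ‖M i j‖ ≤ c) : ‖M‖ ≤ Fintype.card ι * c := by
  lift c to NNReal using hc
  rw [Matrix.linfty_opNorm_def]
  suffices h : (Finset.univ.sup fun i => ∑ j, ‖M i j‖₊) ≤ Fintype.card ι * c by exact_mod_cast h
  refine Finset.sup_le fun i _ => ?_
  calc ∑ j, ‖M i j‖₊ ≤ ∑ _j : ι, c := Finset.sum_le_sum fun j _ => h i j
    _ = _ := by simp

end MatrixCalculus

/-! ### The fundamental solution and its dependence on the parameter -/

section FundamentalSolution

/-- Used with `U = e^{tA₀}` to return from the interaction picture: the sum of the intertwined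
coefficients is intertwined with the sum of the original ones. -/
theorem mul_tsum_eq_of_mul_eq {𝔸 : Type*} [NormedRing 𝔸] [NormedAlgebra ℝ 𝔸] {U V S : 𝔸} {ε : ℝ}
    {a b : ℕ → 𝔸} (hVU : V * U = 1) (hUV : U * V = 1) (h : ∀ k, U * b k = a k * U)
    (hS : HasSum (fun k => ε ^ (k + 1) • a k) S) : U * (∑' k, ε ^ (k + 1) • b k) = S * U := by
  have h1 : HasSum (fun k => ε ^ (k + 1) • b k) (V * (S * U)) := by
    refine ((hS.mul_right U).mul_left V).congr_fun fun k => ?_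
    rw [smul_mul_assoc, mul_smul_comm, ← h, ← mul_assoc, hVU, one_mul]
  rw [h1.tsum_eq, ← mul_assoc, hUV, one_mul]

open scoped Matrix.Norms.Operator

variable {ι : Type*} [DecidableEq ι] {Ω ε₀ : ℝ} {A : ℝ → ℝ → Matrix ι ι ℂ}
  {Ac : ℕ → ℝ → Matrix ι ι ℂ} {d : ι → ℂ}

/-- The coefficients `e^{-t A₀} A_k(t) e^{t A₀}` of the system in the interaction picture. -/
noncomputable def interactionCoeff (Ac : ℕ → ℝ → Matrix ι ι ℂ) (d : ι → ℂ) (k : ℕ) (t : ℝ) :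
    Matrix ι ι ℂ :=
  Matrix.of fun i j => Complex.exp (-((d i - d j) * t)) * Ac k t i j

theorem IsModulatedSystem.continuous_interactionCoeff (hA : IsModulatedSystem Ω ε₀ A Ac d)
    (k : ℕ) : Continuous (interactionCoeff Ac d k) := by
  refine continuous_matrix fun i j => ?_
  have := hA.continuous k i j
  simp only [interactionCoeff, Matrix.of_apply]
  fun_prop

theorem IsModulatedSystem.hasDerivAt_entry (hε₀ : 0 < ε₀) (hA : IsModulatedSystem Ω ε₀ A Ac d)
    (t : ℝ) (i j : ι) : HasDerivAt (fun ε => A ε t i j) (Ac 1 t i j) 0 := by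
  refine hasDerivAt_of_hasSum_pow_smul (a := fun n => Ac n t i j) ?_
  filter_upwards [Metric.ball_mem_nhds (0 : ℝ) hε₀] with ε hε
  have := hA.hasSum ε (by simpa using hε) t i j
  simpa [← Complex.ofReal_pow] using this

theorem IsModulatedSystem.hasSum_matrix (hA : IsModulatedSystem Ω ε₀ A Ac d) {ε : ℝ}
    (hε : |ε| < ε₀) (t : ℝ) : HasSum (fun n => ε ^ n • Ac n t) (A ε t) := by
  refine Pi.hasSum.2 fun i => Pi.hasSum.2 fun j => ?_
  refine (hA.hasSum ε hε t i j).congr_fun ?_ 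
  intro n
  simp

variable [Fintype ι]

theorem diagonal_exp_mul_interactionCoeff (Ac : ℕ → ℝ → Matrix ι ι ℂ) (d : ι → ℂ) (k : ℕ)
    (t : ℝ) :
    Matrix.diagonal (fun i => Complex.exp (d i * t)) * interactionCoeff Ac d k t =
      Ac k t * Matrix.diagonal fun i => Complex.exp (d i * t) := by
  ext i j
  rw [Matrix.diagonal_mul, Matrix.mul_diagonal, interactionCoeff, Matrix.of_apply, ← mul_assoc,
    ← Complex.exp_add, mul_comm]
  congr 2
  ring

theorem IsModulatedSystem.exists_bound_interactionCoeff (hε₀ : 0 < ε₀)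
    (hA : IsModulatedSystem Ω ε₀ A Ac d) (R : ℝ) :
    ∃ c : ℕ → ℝ, (∀ k t, |t| ≤ R → ‖interactionCoeff Ac d (k + 1) t‖ ≤ c k) ∧
      Summable fun k => c k * (ε₀ / 2) ^ (k + 1) := by
  obtain ⟨c, hc, hs⟩ := hA.normal
  set E := ∑ i, ∑ j, Real.exp (‖d i - d j‖ * R)
  refine ⟨fun k => Fintype.card ι * (E * c (k + 1)), fun k t ht => ?_, ?_⟩
  -- Nonnegativity of `c (k + 1)` comes from its bounding an entry, so the empty index type is
  -- treated apart.
  · rcases isEmpty_or_nonempty ι with hι | ⟨⟨i₀⟩⟩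
    · simp [Subsingleton.elim (interactionCoeff Ac d (k + 1) t) 0]
    have hc0 : 0 ≤ c (k + 1) := (norm_nonneg _).trans (hc (k + 1) t i₀ i₀)
    refine Matrix.norm_le_card_mul (by positivity) fun i j => ?_
    rw [interactionCoeff, Matrix.of_apply, norm_mul]
    refine mul_le_mul ?_ (hc _ _ _ _) (norm_nonneg _) (by positivity)
    have h1 : ‖Complex.exp (-((d i - d j) * t))‖ ≤ Real.exp (‖d i - d j‖ * R) := by
      refine (Complex.norm_exp_le_exp_norm _).trans (Real.exp_le_exp.2 ?_)
      rw [norm_neg, norm_mul, Complex.norm_real, Real.norm_eq_abs]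
      gcongr
    refine h1.trans ?_
    refine le_trans ?_ (Finset.single_le_sum (f := fun i => ∑ j, Real.exp (‖d i - d j‖ * R))
      (fun i _ => by positivity) (Finset.mem_univ i))
    exact Finset.single_le_sum (f := fun j => Real.exp (‖d i - d j‖ * R))
      (fun i _ => by positivity) (Finset.mem_univ j)
  -- Normal convergence is assumed only strictly inside `ε₀`; this is why the Dyson series uses the
  -- radius `ε₀ / 2`.
  · have h1 := (summable_nat_add_iff 1).2 (hs (ε₀ / 2) (by rw [abs_of_pos] <;> linarith))
    rw [abs_of_pos (by linarith)] at h1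
    refine (h1.mul_left (Fintype.card ι * E)).congr fun k => ?_
    ring

theorem IsModulatedSystem.exists_bound (hA : IsModulatedSystem Ω ε₀ A Ac d) {ε : ℝ}
    (hε : |ε| < ε₀) : ∃ K, ∀ t, ‖A ε t‖ ≤ K := by
  obtain ⟨c, hc, hs⟩ := hA.normal
  refine ⟨Fintype.card ι * ∑' n, |c n * |ε| ^ n|, fun t => ?_⟩
  refine Matrix.norm_le_card_mul (tsum_nonneg fun n => abs_nonneg _) fun i j => ?_
  rw [← (hA.hasSum ε hε t i j).tsum_eq]
  refine tsum_of_norm_bounded (hs ε hε).abs.hasSum fun n => ?_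
  rw [norm_mul, norm_pow, Complex.norm_real, Real.norm_eq_abs, mul_comm]
  exact (mul_le_mul_of_nonneg_right (hc n t i j) (by positivity)).trans (le_abs_self _)

/-- Solutions of the system are determined by their value at one point. -/
theorem IsModulatedSystem.eq_of_hasDerivAt (hA : IsModulatedSystem Ω ε₀ A Ac d) {ε : ℝ}
    (hε : |ε| < ε₀) {X Y : ℝ → Matrix ι ι ℂ} (hX : ∀ t, HasDerivAt X (A ε t * X t) t)
    (hY : ∀ t, HasDerivAt Y (A ε t * Y t) t) {t₀ : ℝ} (h : X t₀ = Y t₀) : X = Y := by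
  obtain ⟨K, hK⟩ := hA.exists_bound hε
  refine ODE_solution_unique_univ (v := fun t M => A ε t * M) (s := fun _ => Set.univ)
    (K := K.toNNReal) (fun t => ?_) (fun t => ⟨hX t, trivial⟩) (fun t => ⟨hY t, trivial⟩) h
  refine (LipschitzWith.of_dist_le_mul fun M N => ?_).lipschitzOnWith
  rw [dist_eq_norm, dist_eq_norm, ← mul_sub]
  refine (norm_mul_le _ _).trans (mul_le_mul_of_nonneg_right ?_ (norm_nonneg _))
  exact (hK t).trans (Real.le_coe_toNNReal K)

/-- The fundamental solution `X(ε,t)`, `X(ε,0) = 1`. -/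
noncomputable def fundamentalSolution (Ac : ℕ → ℝ → Matrix ι ι ℂ) (d : ι → ℂ) (ε t : ℝ) :
    Matrix ι ι ℂ :=
  Matrix.diagonal (fun i => Complex.exp (d i * t)) *
    dysonSeries (fun k => interactionCoeff Ac d (k + 1)) ε t

theorem fundamentalSolution_zero_right (Ac : ℕ → ℝ → Matrix ι ι ℂ) (d : ι → ℂ) (ε : ℝ) :
    fundamentalSolution Ac d ε 0 = 1 := by
  simp [fundamentalSolution, dysonSeries_zero]

theorem fundamentalSolution_zero_left (Ac : ℕ → ℝ → Matrix ι ι ℂ) (d : ι → ℂ) (t : ℝ) :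
    fundamentalSolution Ac d 0 t = Matrix.diagonal fun i => Complex.exp (d i * t) := by
  rw [fundamentalSolution, dysonSeries, tsum_eq_single 0]
  · simp [dysonTerm_zero]
  · intro k hk
    simp [hk]

theorem IsModulatedSystem.hasDerivAt_fundamentalSolution (hε₀ : 0 < ε₀)
    (hA : IsModulatedSystem Ω ε₀ A Ac d) {ε : ℝ} (hε : |ε| < ε₀ / 2) (t : ℝ) :
    HasDerivAt (fundamentalSolution Ac d ε) (A ε t * fundamentalSolution Ac d ε t) t := by
  have hY := hasDerivAt_dysonSeries (fun k => hA.continuous_interactionCoeff (k + 1))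
    (half_pos hε₀) (hA.exists_bound_interactionCoeff hε₀) hε t
  set Y := dysonSeries (fun k => interactionCoeff Ac d (k + 1)) ε
  set E : ℝ → Matrix ι ι ℂ := fun t => Matrix.diagonal fun i => Complex.exp (d i * t)
  have hE : HasDerivAt E (Matrix.diagonal d * E t) t := by
    refine Matrix.hasDerivAt_iff.2 fun i j => ?_
    simp only [E, Matrix.diagonal_mul, Matrix.diagonal_apply]
    split_ifs with h
    · have h1 : HasDerivAt (fun s : ℝ => d i * (s : ℂ)) (d i) t := by
        simpa using (Complex.ofRealCLM.hasDerivAt (x := t)).const_mul (d i)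
      simpa [mul_comm] using h1.cexp
    · simpa using hasDerivAt_const t (0 : ℂ)
  have hsum : E t * (∑' k, ε ^ (k + 1) • interactionCoeff Ac d (k + 1) t) =
      (A ε t - Matrix.diagonal d) * E t := by
    have hS : HasSum (fun k => ε ^ (k + 1) • Ac (k + 1) t) (A ε t - Matrix.diagonal d) := by
      have := (hasSum_nat_add_iff' 1).2 (hA.hasSum_matrix (by linarith) t)
      simpa [hA.static t] using this
    have hinv : Matrix.diagonal (fun i => Complex.exp (-(d i * t))) * E t = 1 := by
      simp only [E, Matrix.diagonal_mul_diagonal, ← Complex.exp_add]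
      simp
    exact mul_tsum_eq_of_mul_eq hinv (mul_eq_one_comm.1 hinv)
      (fun k => diagonal_exp_mul_interactionCoeff Ac d (k + 1) t) hS
  refine (hE.mul hY).congr_deriv ?_
  refine ((congrArg (Matrix.diagonal d * E t * Y t + ·) ((mul_assoc (E t) _ (Y t)).symm.trans
    (congrArg (· * Y t) hsum)))).trans ?_
  change Matrix.diagonal d * E t * Y t + (A ε t - Matrix.diagonal d) * E t * Y t =
    A ε t * (E t * Y t)
  noncomm_ring

theorem IsModulatedSystem.hasSum_fundamentalSolution (hε₀ : 0 < ε₀)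
    (hA : IsModulatedSystem Ω ε₀ A Ac d) (t : ℝ) :
    ∀ᶠ ε in 𝓝 (0 : ℝ), HasSum (fun n => ε ^ n •
      (Matrix.diagonal (fun i => Complex.exp (d i * t)) *
        dysonTerm (fun k => interactionCoeff Ac d (k + 1)) n t))
      (fundamentalSolution Ac d ε t) := by
  filter_upwards [Metric.ball_mem_nhds (0 : ℝ) (half_pos hε₀)] with ε hε
  have h1 : |ε| < ε₀ / 2 := by simpa using hε
  have h2 := (summable_norm_dysonTerm (half_pos hε₀)
    (hA.exists_bound_interactionCoeff hε₀) h1 t).of_norm.hasSum.mul_left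
      (Matrix.diagonal (fun i => Complex.exp (d i * t)))
  exact h2.congr_fun fun n => (mul_smul_comm _ _ _).symm

theorem IsModulatedSystem.analyticAt_fundamentalSolution (hε₀ : 0 < ε₀)
    (hA : IsModulatedSystem Ω ε₀ A Ac d) (t : ℝ) :
    AnalyticAt ℝ (fun ε => fundamentalSolution Ac d ε t) 0 :=
  (hasFPowerSeriesAt_of_hasSum_pow_smul
    (hA.hasSum_fundamentalSolution hε₀ t)).analyticAt

theorem IsModulatedSystem.hasDerivAt_fundamentalSolution_parameter (hε₀ : 0 < ε₀)
    (hA : IsModulatedSystem Ω ε₀ A Ac d) (t : ℝ) (i j : ι) :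
    HasDerivAt (fun ε => fundamentalSolution Ac d ε t i j)
      (Complex.exp (d i * t) *
        ∫ s in (0 : ℝ)..t, Complex.exp (-((d i - d j) * s)) * Ac 1 s i j) 0 := by
  have h1 := hasDerivAt_of_hasSum_pow_smul (hA.hasSum_fundamentalSolution hε₀ t)
  refine (Matrix.hasDerivAt_iff.1 h1 i j).congr_deriv ?_
  rw [Matrix.diagonal_mul, dysonTerm_succ]
  simp only [zero_add, Finset.range_one, Finset.sum_singleton, dysonTerm_zero, mul_one]
  congr 1
  have := ((Matrix.entryLinearMap ℝ ℂ i j).toContinuousLinearMap).intervalIntegral_comp_comm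
    ((hA.continuous_interactionCoeff 1).intervalIntegrable (μ := MeasureTheory.volume) 0 t)
  exact this.symm

end FundamentalSolution

/-! ### Existence of the Floquet form and its first order coefficient -/

section FloquetForm

open scoped Matrix.Norms.Operator

variable {ι : Type*}

theorem foldedEntry_im_mem {Ω : ℝ} (hΩ : 0 < Ω) (d : ι → ℂ) (j : ι) :
    (foldedEntry Ω d j).im ∈ Set.Ico (-(Ω / 2)) (Ω / 2) := by
  have := (foldingNumber_spec hΩ (d j).im _).2 rfl
  simpa [foldedEntry, mul_comm] using this

theorem exp_period_mul_foldedEntry {Ω : ℝ} (hΩ : 0 < Ω) (d : ι → ℂ) (j : ι) :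
    Complex.exp ((2 * Real.pi / Ω : ℝ) * foldedEntry Ω d j) =
      Complex.exp (d j * (2 * Real.pi / Ω : ℝ)) := by
  rw [Complex.exp_eq_exp_iff_exists_int]
  refine ⟨-foldingNumber Ω (d j).im, ?_⟩
  have : (Ω : ℂ) ≠ 0 := by exact_mod_cast hΩ.ne'
  rw [foldedEntry]
  push_cast
  field_simp
  ring

/-- Equal exponentials force the folded entries to differ by `inΩ` with `n` an integer. Imaginary
parts in a half-open interval of length `Ω` leave only `n = 0`. -/
theorem exp_period_mul_foldedEntry_inj {Ω : ℝ} (hΩ : 0 < Ω) (d : ι → ℂ) (i j : ι)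
    (h : Complex.exp ((2 * Real.pi / Ω : ℝ) * foldedEntry Ω d i) =
      Complex.exp ((2 * Real.pi / Ω : ℝ) * foldedEntry Ω d j)) :
    foldedEntry Ω d i = foldedEntry Ω d j := by
  obtain ⟨n, hn⟩ := Complex.exp_eq_exp_iff_exists_int.1 h
  have hΩ' : (Ω : ℂ) ≠ 0 := by exact_mod_cast hΩ.ne'
  have hπ : (Real.pi : ℂ) ≠ 0 := by exact_mod_cast Real.pi_ne_zero
  have h1 : foldedEntry Ω d i = foldedEntry Ω d j + ((n * Ω : ℝ) : ℂ) * Complex.I := by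
    push_cast at hn ⊢
    field_simp at hn
    linear_combination hn
  have h2 : (foldedEntry Ω d i).im = (foldedEntry Ω d j).im + n * Ω := by
    rw [h1]
    simp
  have hi := foldedEntry_im_mem hΩ d i
  have hj := foldedEntry_im_mem hΩ d j
  have hlt : (n : ℝ) < 1 := by
    by_contra hc
    nlinarith [hi.2, hj.1]
  have hgt : (-1 : ℝ) < n := by
    by_contra hc
    nlinarith [hi.1, hj.2]
  have hn0 : n = 0 := by
    have : n < 1 := by exact_mod_cast hlt
    have : -1 < n := by exact_mod_cast hgt
    omega
  rw [h1, hn0]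
  simp

theorem sub_eq_of_foldedEntry_eq {Ω : ℝ} {d : ι → ℂ} {i j : ι}
    (h : foldedEntry Ω d i = foldedEntry Ω d j) :
    d i - d j = Complex.I *
      ((Ω * (foldingNumber Ω (d i).im - foldingNumber Ω (d j).im : ℤ) : ℝ) : ℂ) := by
  rw [foldedEntry, foldedEntry] at h
  push_cast at h ⊢
  linear_combination h

variable [DecidableEq ι] {Ω ε₀ : ℝ} {A : ℝ → ℝ → Matrix ι ι ℂ}
  {Ac : ℕ → ℝ → Matrix ι ι ℂ} {d : ι → ℂ}

theorem IsModulatedSystem.periodic_coeff (hA : IsModulatedSystem Ω ε₀ A Ac d) {ε : ℝ}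
    (hε : |ε| < ε₀) (t : ℝ) : A ε (t + 2 * Real.pi / Ω) = A ε t := by
  ext i j
  refine (hA.hasSum ε hε _ i j).unique ?_
  have h := hA.hasSum ε hε t i j
  simpa only [fun n => hA.periodic n t] using h

variable [Fintype ι]

theorem IsModulatedSystem.fundamentalSolution_add_period (hε₀ : 0 < ε₀)
    (hA : IsModulatedSystem Ω ε₀ A Ac d) {ε : ℝ} (hε : |ε| < ε₀ / 2) (t : ℝ) :
    fundamentalSolution Ac d ε (t + 2 * Real.pi / Ω) =
      fundamentalSolution Ac d ε t * fundamentalSolution Ac d ε (2 * Real.pi / Ω) := by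
  have hε' : |ε| < ε₀ := by linarith
  refine congrFun (hA.eq_of_hasDerivAt hε' (t₀ := 0)
    (X := fun t => fundamentalSolution Ac d ε (t + 2 * Real.pi / Ω))
    (Y := fun t => fundamentalSolution Ac d ε t * fundamentalSolution Ac d ε (2 * Real.pi / Ω))
    (fun s => ?_) (fun s => ?_) ?_) t
  · have := (hA.hasDerivAt_fundamentalSolution hε₀ hε (s + 2 * Real.pi / Ω)).comp_add_const
      s (2 * Real.pi / Ω)
    rwa [hA.periodic_coeff hε' s] at this
  · have := (hA.hasDerivAt_fundamentalSolution hε₀ hε s).mul_const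
      (fundamentalSolution Ac d ε (2 * Real.pi / Ω))
    exact this.congr_deriv (mul_assoc _ _ _)
  · simp [fundamentalSolution_zero_right]

theorem fundamentalSolution_period_zero (hΩ : 0 < Ω) :
    fundamentalSolution Ac d 0 (2 * Real.pi / Ω) = NormedSpace.exp
      (Matrix.diagonal fun i => ((2 * Real.pi / Ω : ℝ) : ℂ) * foldedEntry Ω d i) := by
  rw [fundamentalSolution_zero_left, Matrix.exp_diagonal_complex]
  simp only [exp_period_mul_foldedEntry hΩ]

theorem Matrix.exp_smul_mul_exp_neg_smul (F : Matrix ι ι ℂ) (t : ℂ) :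
    NormedSpace.exp (-(t • F)) * NormedSpace.exp (t • F) = 1 := by
  rw [← Matrix.exp_add_of_commute _ _ (show Commute (-(t • F)) (t • F) by simp [Commute, SemiconjBy]), neg_add_cancel,
    NormedSpace.exp_zero]

theorem Matrix.exp_add_smul (F : Matrix ι ι ℂ) (s t : ℂ) :
    NormedSpace.exp ((s + t) • F) = NormedSpace.exp (s • F) * NormedSpace.exp (t • F) := by
  rw [add_smul, Matrix.exp_add_of_commute]
  exact ((Commute.refl F).smul_left _).smul_right _

theorem IsModulatedSystem.exists_isFloquetForm (hΩ : 0 < Ω) (hε₀ : 0 < ε₀)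
    (hA : IsModulatedSystem Ω ε₀ A Ac d) : ∃ P F, IsFloquetForm Ω A d P F := by
  set T : ℝ := 2 * Real.pi / Ω with hT
  have hT0 : (T : ℂ) ≠ 0 := by
    have : 0 < T := by positivity
    exact_mod_cast this.ne'
  set X := fundamentalSolution Ac d
  set D : Matrix ι ι ℂ := Matrix.diagonal fun i => (T : ℂ) * foldedEntry Ω d i with hD
  have hX0 : X 0 T = NormedSpace.exp D := fundamentalSolution_period_zero hΩ
  -- `g` is the branch of the logarithm near `exp D` with value `D = T F₀` there; this choice gives
  -- `F 0 = F₀`.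
  obtain ⟨g, hg, hgD, -, hright⟩ := (NormedSpace.exp_analytic (𝕂 := ℂ) D).exists_local_inverse
    (fderiv_exp_diagonal_injective fun i j h => by
      rw [exp_period_mul_foldedEntry_inj hΩ d i j h])
  have hXan : AnalyticAt ℝ (fun ε => X ε T) 0 := hA.analyticAt_fundamentalSolution hε₀ T
  replace hg : AnalyticAt ℂ g (X 0 T) := hX0.symm ▸ hg
  replace hright : ∀ᶠ y in 𝓝 (X 0 T), NormedSpace.exp (g y) = y := hX0.symm ▸ hright
  replace hgD : g (X 0 T) = D := hX0.symm ▸ hgD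
  set F : ℝ → Matrix ι ι ℂ := fun ε => (T : ℂ)⁻¹ • g (X ε T) with hF
  have hFan : AnalyticAt ℝ F 0 := by
    have h1 : AnalyticAt ℝ (fun ε => g (X ε T)) 0 :=
      (hg.restrictScalars (𝕜 := ℝ)).comp_of_eq hXan rfl
    exact (analyticAt_const (v := (T : ℂ)⁻¹)).fun_smul h1
  have hexpF : ∀ᶠ ε in 𝓝 (0 : ℝ), NormedSpace.exp ((T : ℂ) • F ε) = X ε T := by
    filter_upwards [hXan.continuousAt.eventually hright] with ε hε
    simp only [F, smul_smul, mul_inv_cancel₀ hT0, one_smul]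
    exact hε
  have hsmall : ∀ᶠ ε in 𝓝 (0 : ℝ), |ε| < ε₀ / 2 := by
    filter_upwards [Metric.ball_mem_nhds (0 : ℝ) (half_pos hε₀)] with ε hε
    simpa using hε
  have hPX : ∀ ε t : ℝ, X ε t * NormedSpace.exp (-((t : ℂ) • F ε)) *
      NormedSpace.exp ((t : ℂ) • F ε) = X ε t := fun ε t => by
    rw [mul_assoc, Matrix.exp_smul_mul_exp_neg_smul, mul_one]
  refine ⟨fun ε t => X ε t * NormedSpace.exp (-((t : ℂ) • F ε)), F, ?_, ?_, ?_, ?_, ?_, ?_⟩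
  · filter_upwards [hsmall] with ε hε t
    simp only [hPX]
    exact Matrix.hasDerivAt_iff.1 (hA.hasDerivAt_fundamentalSolution hε₀ hε t)
  · refine Eventually.of_forall fun ε => ?_
    simp [X, fundamentalSolution_zero_right]
  · filter_upwards [hsmall, hexpF] with ε hε hε' t
    have h1 : X ε (t + T) = X ε t * X ε T := hA.fundamentalSolution_add_period hε₀ hε t
    have h2 : NormedSpace.exp (-(((t + T : ℝ) : ℂ) • F ε)) =
        NormedSpace.exp (-((T : ℂ) • F ε)) * NormedSpace.exp (-((t : ℂ) • F ε)) := by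
      rw [← neg_smul, ← neg_smul, ← neg_smul, ← Matrix.exp_add_smul]
      push_cast
      congr 2
      ring
    have h3 : X ε T * NormedSpace.exp (-((T : ℂ) • F ε)) = 1 := by
      rw [← hε', mul_eq_one_comm]
      exact Matrix.exp_smul_mul_exp_neg_smul _ _
    change X ε (t + T) * NormedSpace.exp (-(((t + T : ℝ) : ℂ) • F ε)) = _
    rw [h1, h2, mul_assoc, ← mul_assoc (X ε T), h3, one_mul]
  · intro t
    refine Matrix.analyticAt_iff.1 ?_
    have h1 : AnalyticAt ℝ (fun ε => -((t : ℂ) • F ε)) 0 :=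
      ((analyticAt_const (v := (t : ℂ))).fun_smul hFan).fun_neg
    exact (hA.analyticAt_fundamentalSolution hε₀ t).fun_mul
      ((NormedSpace.exp_analytic (𝕂 := ℝ) _).comp h1)
  · exact Matrix.analyticAt_iff.1 hFan
  · simp only [F, hgD, hD]
    ext i j
    rw [Matrix.smul_apply, Matrix.diagonal_apply, Matrix.diagonal_apply]
    split_ifs with h
    · rw [smul_eq_mul, inv_mul_cancel_left₀ hT0]
    · simp

theorem IsFloquetForm.hasDerivAt_firstCoeff {P : ℝ → ℝ → Matrix ι ι ℂ} {F : ℝ → Matrix ι ι ℂ}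
    (hF : IsFloquetForm Ω A d P F) : HasDerivAt F (firstCoeff F) 0 :=
  Matrix.hasDerivAt_iff.2 fun i j => (hF.analytic_F i j).differentiableAt.hasDerivAt

/-- Uniqueness for the initial value problem identifies any Floquet form with the constructed
solution. At `t = T` the periodic factor is `P ε 0 = 1`. -/
theorem IsFloquetForm.exp_period_eventually_eq (hε₀ : 0 < ε₀)
    (hA : IsModulatedSystem Ω ε₀ A Ac d) {P : ℝ → ℝ → Matrix ι ι ℂ} {F : ℝ → Matrix ι ι ℂ}
    (hF : IsFloquetForm Ω A d P F) :
    ∀ᶠ ε in 𝓝 (0 : ℝ), NormedSpace.exp (((2 * Real.pi / Ω : ℝ) : ℂ) • F ε) =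
      fundamentalSolution Ac d ε (2 * Real.pi / Ω) := by
  filter_upwards [Metric.ball_mem_nhds (0 : ℝ) (half_pos hε₀), hF.fundamental, hF.initial,
    hF.periodic] with ε hε h1 h2 h3
  have hε1 : |ε| < ε₀ / 2 := by simpa using hε
  have h4 := congrFun (hA.eq_of_hasDerivAt (by linarith) (t₀ := 0)
    (X := fun s => P ε s * NormedSpace.exp ((s : ℂ) • F ε)) (Y := fundamentalSolution Ac d ε)
    (fun t => Matrix.hasDerivAt_iff.2 (h1 t))
    (hA.hasDerivAt_fundamentalSolution hε₀ hε1)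
    (by simp [h2, fundamentalSolution_zero_right])) (2 * Real.pi / Ω)
  have h5 : P ε (2 * Real.pi / Ω) = 1 := by
    have := h3 0
    rwa [zero_add, h2] at this
  simpa only [h5, one_mul] using h4

/-- The first order coefficient of the Floquet exponent matrix between resonant positions. -/
theorem IsFloquetForm.firstCoeff_eq (hΩ : 0 < Ω) (hε₀ : 0 < ε₀)
    (hA : IsModulatedSystem Ω ε₀ A Ac d) {P : ℝ → ℝ → Matrix ι ι ℂ} {F : ℝ → Matrix ι ι ℂ}
    (hF : IsFloquetForm Ω A d P F) {i j : ι} (hij : foldedEntry Ω d i = foldedEntry Ω d j) :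
    firstCoeff F i j = matrixFourierCoeff Ω (Ac 1)
      (foldingNumber Ω (d i).im - foldingNumber Ω (d j).im) i j := by
  set T : ℝ := 2 * Real.pi / Ω with hT
  have hT0 : (T : ℂ) ≠ 0 := by
    have : 0 < T := by positivity
    exact_mod_cast this.ne'
  set D : Matrix ι ι ℂ := Matrix.diagonal fun i => (T : ℂ) * foldedEntry Ω d i with hD
  have hTF : HasDerivAt (fun ε => (T : ℂ) • F ε) ((T : ℂ) • firstCoeff F) 0 :=
    hF.hasDerivAt_firstCoeff.const_smul (T : ℂ)
  have h0 : (T : ℂ) • F 0 = D := by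
    rw [hF.zero, hD]
    ext a b
    simp [Matrix.diagonal_apply]
  have hexp := (NormedSpace.exp_analytic (𝕂 := ℂ) D).differentiableAt.hasFDerivAt.restrictScalars ℝ
  rw [← h0] at hexp
  have h1 := hexp.comp_hasDerivAt (0 : ℝ) hTF
  rw [h0] at h1
  have h2 := h1.congr_of_eventuallyEq
    ((hF.exp_period_eventually_eq hε₀ hA).mono fun ε h => h.symm)
  have h3 := (Matrix.hasDerivAt_iff.1 h2 i j).unique
    (hA.hasDerivAt_fundamentalSolution_parameter hε₀ T i j)
  have h4 := (fderiv_exp_diagonal_apply _ ((T : ℂ) • firstCoeff F) i j).symm.trans h3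
  -- At a resonant position the derivative of `exp` multiplies by `e^{T fᵢ} = e^{T dᵢ}`, which is
  -- also the prefactor in the derivative of the monodromy matrix and cancels.
  rw [if_pos (by rw [hij]), exp_period_mul_foldedEntry hΩ] at h4
  have h5 := mul_left_cancel₀ (Complex.exp_ne_zero _) h4
  rw [Matrix.smul_apply, smul_eq_mul] at h5
  rw [matrixFourierCoeff, Matrix.of_apply]
  have h6 : ((Ω / (2 * Real.pi) : ℝ) : ℂ) = (T : ℂ)⁻¹ := by
    rw [hT, ← Complex.ofReal_inv, inv_div]
  rw [h6, eq_inv_mul_iff_mul_eq₀ hT0, h5]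
  refine intervalIntegral.integral_congr fun s _ => ?_
  rw [sub_eq_of_foldedEntry_eq hij, mul_comm]
  congr 3
  push_cast
  ring

end FloquetForm

/-! ### Perturbation of a double root of a quadratic -/

section QuadraticSplitting

/-- The roots of the characteristic polynomial of a `2 × 2` matrix
`(a b; c e) = f₀ + ε (0 b₁; c₁ 0) + O(ε²)`. -/
theorem exists_roots_two_by_two {a b c e : ℝ → ℂ} {f₀ b₁ c₁ s : ℂ}
    (ha : (fun ε => a ε - f₀) =O[𝓝 0] fun ε : ℝ => ε ^ 2)
    (he : (fun ε => e ε - f₀) =O[𝓝 0] fun ε : ℝ => ε ^ 2)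
    (hb : (fun ε => b ε - ε * b₁) =O[𝓝 0] fun ε : ℝ => ε ^ 2)
    (hc : (fun ε => c ε - ε * c₁) =O[𝓝 0] fun ε : ℝ => ε ^ 2)
    (hs : s ^ 2 = b₁ * c₁) (h0 : b₁ = 0 ↔ c₁ = 0) :
    ∃ f₁ f₂ : ℝ → ℂ, (∀ ε, f₁ ε + f₂ ε = a ε + e ε ∧ f₁ ε * f₂ ε = a ε * e ε - b ε * c ε) ∧
      (fun ε : ℝ => f₁ ε - (f₀ + ε * s)) =O[𝓝 0] (fun ε : ℝ => ε ^ 2) ∧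
      (fun ε : ℝ => f₂ ε - (f₀ - ε * s)) =O[𝓝 0] (fun ε : ℝ => ε ^ 2) := by
  -- `σ` is half the difference of the roots, with the sign for which it is at least as close to
  -- `εs` as to `-εs`. No regularity in `ε` is needed.
  have hroot : ∀ ε : ℝ, ∃ σ : ℂ, σ ^ 2 = ((a ε - e ε) / 2) ^ 2 + b ε * c ε ∧
      ‖σ - ε * s‖ ≤ ‖σ + ε * s‖ := by
    intro ε
    obtain ⟨σ, hσ⟩ := IsAlgClosed.exists_eq_mul_self (((a ε - e ε) / 2) ^ 2 + b ε * c ε)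
    rcases le_total ‖σ - ε * s‖ ‖σ + ε * s‖ with h | h
    · exact ⟨σ, by rw [hσ, sq], h⟩
    · refine ⟨-σ, by rw [hσ]; ring, ?_⟩
      rw [show -σ - ε * s = -(σ + ε * s) by ring, show -σ + ε * s = -(σ - ε * s) by ring,
        norm_neg, norm_neg]
      exact h
  choose σ hσ hle using hroot
  have hδ : (fun ε => (a ε - e ε) / 2) =O[𝓝 0] fun ε : ℝ => ε ^ 2 := by
    refine ((ha.sub he).const_mul_left (1 / 2)).congr_left fun ε => ?_
    ring
  have hτ : (fun ε => (a ε + e ε) / 2 - f₀) =O[𝓝 0] fun ε : ℝ => ε ^ 2 := by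
    refine ((ha.add he).const_mul_left (1 / 2)).congr_left fun ε => ?_
    ring
  have hsq : (fun ε : ℝ => ε ^ 2) =O[𝓝 0] fun ε : ℝ => ε := by
    refine IsBigO.of_bound 1 ?_
    filter_upwards [Metric.closedBall_mem_nhds (0 : ℝ) one_pos] with ε hε
    rw [mem_closedBall_zero_iff] at hε
    rw [norm_pow, one_mul]
    exact pow_le_of_le_one (norm_nonneg _) hε two_ne_zero
  have hε (z : ℂ) : (fun ε : ℝ => (ε : ℂ) * z) =O[𝓝 0] fun ε : ℝ => ε := by
    refine IsBigO.of_bound ‖z‖ (Eventually.of_forall fun ε => ?_)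
    rw [norm_mul, Complex.norm_real, mul_comm]
  have hmain : (fun ε => σ ε - ε * s) =O[𝓝 0] fun ε : ℝ => ε ^ 2 := by
    -- For `s = 0` the hypothesis `h0` makes both `b₁` and `c₁` vanish, so `σ² = O(ε⁴)`. Otherwise
    -- `(σ - εs)(σ + εs) = O(ε³)`, and the choice of sign bounds the second factor below by `|ε|
    -- ‖s‖`.
    by_cases hs0 : s = 0
    · have hbc : b₁ = 0 ∧ c₁ = 0 := by
        rw [hs0, zero_pow two_ne_zero, eq_comm, mul_eq_zero] at hs
        tauto
      simp only [hbc.1, hbc.2, mul_zero, sub_zero] at hb hc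
      have h1 : (fun ε => σ ε ^ 2) =O[𝓝 0] fun ε : ℝ => (ε ^ 2) ^ 2 := by
        refine ((hδ.pow 2).add ((hb.mul hc).congr_right fun ε => ?_)).congr_left fun ε => ?_
        · ring
        · exact (hσ ε).symm
      simpa [hs0] using h1.of_pow two_ne_zero
    · have hcε : c =O[𝓝 0] fun ε : ℝ => ε := by
        refine ((hc.trans hsq).add (hε c₁)).congr_left fun ε => ?_
        ring
      have h1 : (fun ε => (σ ε - ε * s) * (σ ε + ε * s)) =O[𝓝 0] fun ε : ℝ => ε ^ 3 := by
        have e1 : (fun ε : ℝ => ((a ε - e ε) / 2) ^ 2) =O[𝓝 0] fun ε : ℝ => ε ^ 3 := by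
          refine ((hδ.mul (hδ.trans hsq)).congr_left fun ε => ?_).congr_right fun ε => ?_
          · ring
          · ring
        have e2 := hb.mul hcε
        have e3 := (hε b₁).mul hc
        refine ((e1.add (e2.congr_right fun ε => ?_)).add
          (e3.congr_right fun ε => ?_)).congr_left fun ε => ?_
        · ring
        · ring
        · linear_combination (-1 : ℂ) * hσ ε + (ε : ℂ) ^ 2 * hs
      obtain ⟨C, hC⟩ := h1.bound
      refine IsBigO.of_bound (C / ‖s‖) (hC.mono fun ε h => ?_)
      rw [norm_mul] at h
      have hs1 : 0 < ‖s‖ := norm_pos_iff.2 hs0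
      have h2 : ‖(ε : ℂ) * s‖ ≤ ‖σ ε + ε * s‖ := by
        have : ‖(2 : ℂ) * (ε * s)‖ ≤ ‖σ ε + ε * s‖ + ‖σ ε - ε * s‖ := by
          refine le_trans (le_of_eq ?_) (norm_sub_le _ _)
          congr 1
          ring
        rw [norm_mul, Complex.norm_ofNat] at this
        linarith [hle ε]
      rw [norm_mul, Complex.norm_real, Real.norm_eq_abs] at h2
      rw [norm_pow, Real.norm_eq_abs] at h ⊢
      rw [div_mul_eq_mul_div, le_div_iff₀ hs1]
      -- The filter `𝓝 0` includes the point `0`, where division by `|ε|` is not possible; there the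
      -- product vanishes and the smaller factor with it.
      rcases eq_or_ne ε 0 with rfl | hε0
      · have h3 : ‖σ 0 - ((0 : ℝ) : ℂ) * s‖ * ‖σ 0 + ((0 : ℝ) : ℂ) * s‖ ≤ 0 := by simpa using h
        have h4 := hle 0
        have h5 : ‖σ 0 - ((0 : ℝ) : ℂ) * s‖ = 0 := by
          nlinarith [norm_nonneg (σ 0 - ((0 : ℝ) : ℂ) * s)]
        rw [h5]
        simp
      · have hε1 : 0 < |ε| := abs_pos.2 hε0
        have h3 : ‖σ ε - ε * s‖ * (|ε| * ‖s‖) ≤ C * |ε| ^ 3 :=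
          (mul_le_mul_of_nonneg_left h2 (norm_nonneg _)).trans h
        refine le_of_mul_le_mul_left ?_ hε1
        linarith
  refine ⟨fun ε => (a ε + e ε) / 2 + σ ε, fun ε => (a ε + e ε) / 2 - σ ε, fun ε => ⟨by ring, ?_⟩,
    ?_, ?_⟩
  · linear_combination -(hσ ε)
  · exact (hτ.add hmain).congr_left fun ε => by ring
  · exact (hτ.sub hmain).congr_left fun ε => by ring

end QuadraticSplitting

/-! ### Characteristic polynomials of block triangular matrices -/

section CharpolyBlocks

variable {ι R : Type*} [Fintype ι] [DecidableEq ι] [CommRing R]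

theorem Matrix.charpoly_eq_mul_of_twoBlockTriangular (M : Matrix ι ι R) (P : ι → Prop)
    [DecidablePred P] (h : ∀ i, ¬P i → ∀ j, P j → M i j = 0) :
    M.charpoly = (M.toSquareBlockProp P).charpoly *
      (M.toSquareBlockProp fun i => ¬P i).charpoly := by
  have hblock (Q : ι → Prop) [DecidablePred Q] :
      M.charmatrix.toSquareBlockProp Q = (M.toSquareBlockProp Q).charmatrix := by
    ext i j : 2
    simp [Matrix.toSquareBlockProp_def, Matrix.charmatrix_apply, Matrix.diagonal_apply,
      Subtype.ext_iff]
  rw [Matrix.charpoly, Matrix.twoBlockTriangular_det _ P, hblock, hblock]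
  · rfl
  · intro i hi j hj
    have hij : i ≠ j := fun hij => hi (hij ▸ hj)
    rw [Matrix.charmatrix_apply_ne _ _ _ hij, h i hi j hj, map_zero, neg_zero]

theorem Matrix.charpoly_toSquareBlockProp_pair (M : Matrix ι ι ℂ) {p q : ι} (hpq : p ≠ q)
    (P : ι → Prop) [DecidablePred P] (hP : ∀ j, P j ↔ j = p ∨ j = q) {f₁ f₂ : ℂ}
    (hadd : f₁ + f₂ = M p p + M q q) (hmul : f₁ * f₂ = M p p * M q q - M p q * M q p) :
    (M.toSquareBlockProp P).charpoly.roots = {f₁, f₂} := by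
  let φ : Fin 2 → {j // P j} := ![⟨p, (hP p).2 (Or.inl rfl)⟩, ⟨q, (hP q).2 (Or.inr rfl)⟩]
  have hφ : Function.Bijective φ := by
    constructor
    · intro x y hxy
      fin_cases x <;> fin_cases y <;> simp [φ, hpq, hpq.symm] at hxy ⊢
    · rintro ⟨j, hj⟩
      rcases (hP j).1 hj with rfl | rfl
      · exact ⟨0, rfl⟩
      · exact ⟨1, rfl⟩
  let e := (Equiv.ofBijective φ hφ).symm
  rw [← Matrix.charpoly_reindex e, Matrix.charpoly_fin_two]
  have h1 : (Matrix.reindex e e (M.toSquareBlockProp P)).trace = f₁ + f₂ := by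
    rw [hadd, Matrix.trace_fin_two]
    rfl
  have h2 : (Matrix.reindex e e (M.toSquareBlockProp P)).det = f₁ * f₂ := by
    rw [hmul, Matrix.det_fin_two]
    rfl
  rw [h1, h2]
  have h3 : (Polynomial.X ^ 2 - Polynomial.C (f₁ + f₂) * Polynomial.X + Polynomial.C (f₁ * f₂) :
      Polynomial ℂ) = (Polynomial.X - Polynomial.C f₁) * (Polynomial.X - Polynomial.C f₂) := by
    rw [map_add, map_mul]
    ring
  rw [h3, Polynomial.roots_mul (mul_ne_zero (Polynomial.X_sub_C_ne_zero _)
    (Polynomial.X_sub_C_ne_zero _)), Polynomial.roots_X_sub_C, Polynomial.roots_X_sub_C]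
  rfl

end CharpolyBlocks

/-! ### Analytic block triangularization -/

section BlockTriangularization

theorem hasDerivAt_smul_zero {E : Type*} [NormedAddCommGroup E] [NormedSpace ℂ E] (e : E) :
    HasDerivAt (fun s : ℂ => s • e) e 0 := by
  simpa using (hasDerivAt_id (0 : ℂ)).smul_const e

open scoped Matrix.Norms.Operator

variable {ι : Type*}

/-- The part of a matrix which maps the coordinates in `P` to those outside `P`. -/
def Matrix.lowerPart (P : ι → Prop) [DecidablePred P] : Matrix ι ι ℂ →ₗ[ℂ] Matrix ι ι ℂ where
  toFun M := Matrix.of fun i j => if ¬P i ∧ P j then M i j else 0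
  map_add' M N := by
    ext i j
    simp only [Matrix.of_apply, Matrix.add_apply]
    split_ifs <;> simp
  map_smul' c M := by
    ext i j
    simp only [Matrix.of_apply, Matrix.smul_apply, RingHom.id_apply]
    split_ifs <;> simp

theorem Matrix.lowerPart_apply (P : ι → Prop) [DecidablePred P] (M : Matrix ι ι ℂ) (i j : ι) :
    Matrix.lowerPart P M i j = if ¬P i ∧ P j then M i j else 0 := rfl

theorem Matrix.sub_lowerPart_apply_eq_zero (P : ι → Prop) [DecidablePred P] (M : Matrix ι ι ℂ)
    (i : ι) (hi : ¬P i) (j : ι) (hj : P j) : (M - Matrix.lowerPart P M) i j = 0 := by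
  simp [Matrix.lowerPart_apply, hi, hj]

theorem Matrix.sub_lowerPart_apply_of_iff (P : ι → Prop) [DecidablePred P] (M : Matrix ι ι ℂ)
    {i j : ι} (h : P i ∨ ¬P j) : (M - Matrix.lowerPart P M) i j = M i j := by
  rw [Matrix.sub_apply, Matrix.lowerPart_apply, if_neg (by tauto), sub_zero]

theorem Matrix.lowerPart_diagonal [DecidableEq ι] (P : ι → Prop) [DecidablePred P] (v : ι → ℂ) :
    Matrix.lowerPart P (Matrix.diagonal v) = 0 := by
  ext i j
  rw [Matrix.lowerPart_apply, Matrix.diagonal_apply]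
  split_ifs with h1 h2
  · exact absurd (h2 ▸ h1.2) h1.1
  all_goals rfl

variable [Fintype ι]

theorem Matrix.lowerPart_mul_lowerPart (P : ι → Prop) [DecidablePred P] (M N : Matrix ι ι ℂ) :
    Matrix.lowerPart P M * Matrix.lowerPart P N = 0 := by
  ext i j
  rw [Matrix.mul_apply]
  refine Finset.sum_eq_zero fun k _ => ?_
  rw [Matrix.lowerPart_apply, Matrix.lowerPart_apply]
  by_cases h : P k <;> simp [h]

variable [DecidableEq ι]

/-- The conjugate of the block upper triangular part of `M` by `1 + N`, where `N` is the lower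
left block of `M`. -/
def Matrix.blockConj (P : ι → Prop) [DecidablePred P] (M : Matrix ι ι ℂ) : Matrix ι ι ℂ :=
  (1 + Matrix.lowerPart P M) * (M - Matrix.lowerPart P M) * (1 - Matrix.lowerPart P M)

theorem Matrix.analyticAt_blockConj (P : ι → Prop) [DecidablePred P] (M : Matrix ι ι ℂ) :
    AnalyticAt ℂ (Matrix.blockConj P) M := by
  have hN : AnalyticAt ℂ (fun M => Matrix.lowerPart P M) M :=
    (LinearMap.toContinuousLinearMap (Matrix.lowerPart P)).analyticAt M
  exact ((analyticAt_const.fun_add hN).fun_mul (analyticAt_id.fun_sub hN)).fun_mul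
    (analyticAt_const.fun_sub hN)

/-- The lower part squares to zero, so `1 - N` is the inverse of `1 + N` and `blockConj` is a true
conjugation. -/
theorem Matrix.charpoly_blockConj (P : ι → Prop) [DecidablePred P] (M : Matrix ι ι ℂ) :
    (Matrix.blockConj P M).charpoly = (M - Matrix.lowerPart P M).charpoly := by
  have h := Matrix.lowerPart_mul_lowerPart P M M
  have h1 : (1 - Matrix.lowerPart P M) * (1 + Matrix.lowerPart P M) = 1 := by
    rw [sub_mul, mul_add, mul_add, h]
    simp
  rw [Matrix.blockConj, Matrix.charpoly_mul_comm, ← mul_assoc, h1, one_mul]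

theorem Matrix.blockConj_apply (P : ι → Prop) [DecidablePred P] (M : Matrix ι ι ℂ)
    {i j : ι} (hi : P i) (hj : P j) :
    Matrix.blockConj P M i j = M i j - ∑ k, if P k then 0 else M i k * M k j := by
  have h1 : Matrix.blockConj P M i j =
      ((M - Matrix.lowerPart P M) * (1 - Matrix.lowerPart P M)) i j := by
    rw [Matrix.blockConj, mul_assoc, add_mul, one_mul, Matrix.add_apply, add_eq_left,
      Matrix.mul_apply]
    refine Finset.sum_eq_zero fun k _ => ?_
    rw [Matrix.lowerPart_apply, if_neg (by tauto), zero_mul]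
  rw [h1, mul_sub, mul_one, Matrix.sub_apply, Matrix.sub_lowerPart_apply_of_iff P M (Or.inl hi),
    Matrix.mul_apply]
  congr 1
  refine Finset.sum_congr rfl fun k _ => ?_
  rw [Matrix.sub_lowerPart_apply_of_iff P M (Or.inl hi), Matrix.lowerPart_apply]
  by_cases hk : P k <;> simp [hk, hj]

theorem Matrix.blockConj_diagonal (P : ι → Prop) [DecidablePred P] (v : ι → ℂ) :
    Matrix.blockConj P (Matrix.diagonal v) = Matrix.diagonal v := by
  simp [Matrix.blockConj, Matrix.lowerPart_diagonal]

theorem Matrix.fderiv_blockConj_diagonal (P : ι → Prop) [DecidablePred P] (v : ι → ℂ)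
    (H : Matrix ι ι ℂ) :
    fderiv ℂ (Matrix.blockConj P) (Matrix.diagonal v) H =
      H - Matrix.lowerPart P H + (Matrix.lowerPart P H * Matrix.diagonal v -
        Matrix.diagonal v * Matrix.lowerPart P H) := by
  set D := Matrix.diagonal v
  set N := Matrix.lowerPart P H
  refine (Matrix.analyticAt_blockConj P D).differentiableAt.fderiv_apply_eq_of_curve
    (c := fun s => D + s • H) (by simp) ((hasDerivAt_smul_zero H).const_add D) ?_
  have h1 : (fun s : ℂ => Matrix.blockConj P (D + s • H)) =
      fun s => (1 + s • N) * (D + s • (H - N)) * (1 - s • N) := by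
    funext s
    have : Matrix.lowerPart P (D + s • H) = s • N := by
      rw [map_add, map_smul, Matrix.lowerPart_diagonal, zero_add]
    rw [Matrix.blockConj, this, smul_sub, add_sub_assoc]
  rw [h1]
  refine ((((hasDerivAt_smul_zero N).const_add 1).mul ((hasDerivAt_smul_zero (H - N)).const_add D)).mul
    ((hasDerivAt_smul_zero N).const_sub 1)).congr_deriv ?_
  simp only [zero_smul, add_zero, sub_zero, mul_one, one_mul, mul_neg, Pi.mul_apply]
  abel

/-- To first order, conjugation multiplies the lower left entries by `v j - v i` and leaves the
others unchanged. A spectral gap between the blocks thus makes `blockConj` locally invertible: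
nearby matrices are analytically similar to block triangular ones. -/
theorem Matrix.fderiv_blockConj_injective (P : ι → Prop) [DecidablePred P] {v : ι → ℂ}
    (hv : ∀ i j, ¬P i → P j → v i ≠ v j) :
    Function.Injective (fderiv ℂ (Matrix.blockConj P) (Matrix.diagonal v)) := by
  refine (injective_iff_map_eq_zero _).2 fun H hH => ?_
  have h := (Matrix.fderiv_blockConj_diagonal P v H).symm.trans hH
  ext i j
  have hij := congrFun (congrFun h i) j
  simp only [Matrix.add_apply, Matrix.sub_apply, Matrix.mul_diagonal, Matrix.diagonal_mul,
    Matrix.lowerPart_apply] at hij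
  split_ifs at hij with hP
  · have h1 : v j - v i ≠ 0 := sub_ne_zero.2 (hv i j hP.1 hP.2).symm
    have h2 : (v j - v i) * H i j = 0 := by
      refine Eq.trans ?_ hij
      ring
    exact (mul_eq_zero.1 h2).resolve_left h1
  · refine Eq.trans ?_ hij
    ring

end BlockTriangularization

/-! ### The two eigenvalues near the degenerate point -/

section Splitting

open scoped Matrix.Norms.Operator

variable {ι : Type*} [Fintype ι] [DecidableEq ι]

theorem DifferentiableAt.isBigO_of_apply_zero {f : ℝ → ℂ} (h : DifferentiableAt ℝ f 0) (h0 : f 0 = 0) :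
    f =O[𝓝 0] fun ε : ℝ => ε := by
  simpa [h0] using h.isBigO_sub

theorem exists_eventually_not_isRoot_charpoly {κ : Type*} [Fintype κ] [DecidableEq κ]
    {M : ℝ → Matrix κ κ ℂ} (hM : ContinuousAt M 0) {f₀ : ℂ} (h0 : (M 0).charpoly.eval f₀ ≠ 0) :
    ∃ r > 0, ∀ᶠ ε in 𝓝 (0 : ℝ), ∀ z, dist z f₀ < r → ¬(M ε).charpoly.IsRoot z := by
  have hc : ContinuousAt (fun x : ℝ × ℂ => (M x.1).charpoly.eval x.2) (0, f₀) := by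
    simp only [Matrix.eval_charpoly]
    have h1 : ContinuousAt (fun x : ℝ × ℂ => Matrix.scalar κ x.2 - M x.1) (0, f₀) := by
      refine ContinuousAt.sub ?_ (ContinuousAt.comp (f := Prod.fst) (by exact hM) continuousAt_fst)
      have : Continuous fun x : ℝ × ℂ => (Matrix.scalar κ x.2 : Matrix κ κ ℂ) := by
        simp only [Matrix.scalar_apply]
        fun_prop
      exact this.continuousAt
    exact (continuous_id.matrix_det.continuousAt).comp h1
  have h1 := hc.eventually_ne h0
  rw [nhds_prod_eq] at h1
  obtain ⟨pa, hpa, pb, hpb, h2⟩ := eventually_prod_iff.1 h1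
  obtain ⟨r, hr, hr'⟩ := Metric.eventually_nhds_iff.1 hpb
  exact ⟨r, hr, hpa.mono fun ε hε z hz => h2 hε (hr' hz)⟩

theorem hasSplitting_of_analytic {F : ℝ → Matrix ι ι ℂ} {v : ι → ℂ} {f₀ s : ℂ} {p q : ι}
    (hpq : p ≠ q) (hv : ∀ j, v j = f₀ ↔ j = p ∨ j = q)
    (hF : ∀ i j, AnalyticAt ℝ (fun ε => F ε i j) 0) (hF0 : F 0 = Matrix.diagonal v)
    (hpp : firstCoeff F p p = 0) (hqq : firstCoeff F q q = 0)
    (h0 : firstCoeff F p q = 0 ↔ firstCoeff F q p = 0)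
    (hs : s ^ 2 = firstCoeff F p q * firstCoeff F q p) : HasSplitting F f₀ s := by
  classical
  set P : ι → Prop := fun j => v j = f₀ with hP
  set D := Matrix.diagonal v with hD
  have hFan : AnalyticAt ℝ F 0 := Matrix.analyticAt_iff.2 hF
  obtain ⟨g, hg, hgD, -, hright⟩ := (Matrix.analyticAt_blockConj P D).exists_local_inverse
    (Matrix.fderiv_blockConj_injective P fun i j hi hj h => hi (h.trans hj))
  have hfix : Matrix.blockConj P D = D := Matrix.blockConj_diagonal P v
  rw [hfix] at hg hgD hright
  set K : ℝ → Matrix ι ι ℂ := fun ε => g (F ε)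
  have hKan : AnalyticAt ℝ K 0 := by
    rw [← hF0] at hg
    exact (hg.restrictScalars (𝕜 := ℝ)).comp_of_eq hFan rfl
  have hKan' := Matrix.analyticAt_iff.1 hKan
  have hK0 : K 0 = D := by
    simp only [K, hF0]
    exact hgD
  have hKF : ∀ᶠ ε in 𝓝 (0 : ℝ), Matrix.blockConj P (K ε) = F ε := by
    have h1 := hFan.continuousAt
    rw [ContinuousAt, hF0] at h1
    exact h1.eventually hright
  have hsmall (i j : ι) (hij : i ≠ j) : (fun ε => K ε i j) =O[𝓝 0] fun ε : ℝ => ε :=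
    DifferentiableAt.isBigO_of_apply_zero (hKan' i j).differentiableAt (by
      rw [hK0, hD, Matrix.diagonal_apply_ne _ hij])
  -- The blocks of `K` and `F` differ by sums of products of two off-diagonal entries of `K`, each
  -- `O(ε)`; so the first order data of `F` suffice.
  have hdiff (i j : ι) (hi : P i) (hj : P j) :
      (fun ε => K ε i j - F ε i j) =O[𝓝 0] fun ε : ℝ => ε ^ 2 := by
    have h1 : (fun ε => ∑ k, if P k then 0 else K ε i k * K ε k j) =O[𝓝 0]
        fun ε : ℝ => ε ^ 2 := by
      refine IsBigO.fun_sum fun k _ => ?_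
      by_cases hk : P k
      · simpa [hk] using isBigO_zero _ _
      · simp only [hk, if_false, sq]
        exact (hsmall i k fun h => hk (h ▸ hi)).mul (hsmall k j fun h => hk (h ▸ hj))
    refine h1.congr' (hKF.mono fun ε hε => ?_) EventuallyEq.rfl
    have h2 := congrFun (congrFun hε i) j
    rw [Matrix.blockConj_apply P _ hi hj] at h2
    change _ = K ε i j - F ε i j
    rw [← h2]
    ring
  have hexpand (i j : ι) (hi : P i) (hj : P j) :
      (fun ε : ℝ => K ε i j - (D i j + ε * firstCoeff F i j)) =O[𝓝 0] fun ε : ℝ => ε ^ 2 := by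
    have h1 := (hF i j).isBigO_sub_deriv
    refine ((hdiff i j hi hj).add h1).congr_left fun ε => ?_
    rw [hF0, firstCoeff, Matrix.of_apply, Complex.real_smul]
    ring
  have hPp : P p := (hv p).2 (Or.inl rfl)
  have hPq : P q := (hv q).2 (Or.inr rfl)
  obtain ⟨f₁, f₂, hroots, hf₁, hf₂⟩ := exists_roots_two_by_two
    (a := fun ε => K ε p p) (b := fun ε => K ε p q) (c := fun ε => K ε q p)
    (e := fun ε => K ε q q) (f₀ := f₀) (s := s) (b₁ := firstCoeff F p q)
    (c₁ := firstCoeff F q p)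
    (by simpa [hD, hpp, show v p = f₀ from hPp] using hexpand p p hPp hPp)
    (by simpa [hD, hqq, show v q = f₀ from hPq] using hexpand q q hPq hPq)
    (by simpa [hD, hpq] using hexpand p q hPp hPq)
    (by simpa [hD, hpq.symm] using hexpand q p hPq hPp) hs h0
  have hcharpoly (ε : ℝ) (hε : Matrix.blockConj P (K ε) = F ε) : (F ε).charpoly.roots =
      {f₁ ε, f₂ ε} +
        ((K ε - Matrix.lowerPart P (K ε)).toSquareBlockProp fun i => ¬P i).charpoly.roots := by
    rw [← hε, Matrix.charpoly_blockConj, Matrix.charpoly_eq_mul_of_twoBlockTriangular _ P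
      (Matrix.sub_lowerPart_apply_eq_zero P _), Polynomial.roots_mul
        (mul_ne_zero (Matrix.charpoly_monic _).ne_zero (Matrix.charpoly_monic _).ne_zero),
      Matrix.charpoly_toSquareBlockProp_pair _ hpq P hv (f₁ := f₁ ε) (f₂ := f₂ ε)]
    · simpa [Matrix.lowerPart_apply, hPp, hPq] using (hroots ε).1
    · simpa [Matrix.lowerPart_apply, hPp, hPq] using (hroots ε).2
  have hrest : ContinuousAt
      (fun ε => (K ε - Matrix.lowerPart P (K ε)).toSquareBlockProp fun i => ¬P i) 0 := by
    refine continuousAt_pi.2 fun i => continuousAt_pi.2 fun j => ?_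
    refine (hKan' i j).continuousAt.congr (Eventually.of_forall fun ε => ?_)
    exact (Matrix.sub_lowerPart_apply_of_iff P (K ε) (Or.inr j.2)).symm
  -- At `ε = 0` the complementary block is diagonal with entries different from `f₀`, so it
  -- contributes no eigenvalue to a small fixed disc.
  obtain ⟨r, hr, hr'⟩ := exists_eventually_not_isRoot_charpoly hrest (f₀ := f₀) (by
    rw [hK0, hD, Matrix.lowerPart_diagonal, sub_zero, Matrix.eval_charpoly]
    have : (Matrix.scalar {i // ¬P i}) f₀ -
        (Matrix.diagonal v).toSquareBlockProp (fun i => ¬P i) =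
        Matrix.diagonal fun i : {i // ¬P i} => f₀ - v i := by
      ext i j
      simp only [Matrix.toSquareBlockProp_def, Matrix.scalar_apply, Matrix.sub_apply,
        Matrix.diagonal_apply, Matrix.of_apply, Subtype.ext_iff]
      split_ifs <;> simp
    rw [this, Matrix.det_diagonal]
    exact Finset.prod_ne_zero_iff.2 fun i _ => sub_ne_zero.2 fun h => i.2 h.symm)
  have htend (f : ℝ → ℂ) (w : ℂ)
      (hf : (fun ε : ℝ => f ε - (f₀ + ε * w)) =O[𝓝 0] fun ε : ℝ => ε ^ 2) :
      ∀ᶠ ε in 𝓝 (0 : ℝ), dist (f ε) f₀ < r := by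
    have h1 : Tendsto (fun ε : ℝ => f ε - (f₀ + ε * w)) (𝓝 0) (𝓝 0) := by
      refine hf.trans_tendsto ?_
      have : Continuous fun ε : ℝ => ε ^ 2 := by fun_prop
      simpa using this.tendsto 0
    have h2 : Tendsto (fun ε : ℝ => f₀ + (ε : ℂ) * w) (𝓝 0) (𝓝 f₀) := by
      have : Continuous fun ε : ℝ => f₀ + (ε : ℂ) * w := by fun_prop
      simpa using this.tendsto 0
    have h3 : Tendsto f (𝓝 0) (𝓝 f₀) := by simpa using h1.add h2
    exact h3.eventually (Metric.ball_mem_nhds f₀ hr)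
  refine ⟨r, hr, f₁, f₂, ?_, hf₁, hf₂, ?_⟩
  · filter_upwards [hKF, hr', htend f₁ s hf₁, htend f₂ (-s) (by simpa [← sub_eq_add_neg] using hf₂)]
      with ε h1 h2 h3 h4
    rw [hcharpoly ε h1, Multiset.filter_add]
    have h5 := Multiset.filter_eq_nil.2 fun z
      (hz : z ∈ ((K ε - Matrix.lowerPart P (K ε)).toSquareBlockProp fun i => ¬P i).charpoly.roots)
      (hzr : dist z f₀ < r) => h2 z hzr (Polynomial.isRoot_of_mem_roots hz)
    have h6 : Multiset.filter (fun z => dist z f₀ < r) {f₁ ε, f₂ ε} = {f₁ ε, f₂ ε} := by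
      refine Multiset.filter_eq_self.2 fun z hz => ?_
      rcases Multiset.mem_cons.1 hz with rfl | hz
      · exact h3
      · rw [Multiset.mem_singleton.1 hz]
        exact h4
    convert (congrArg₂ (· + ·) h6 h5).trans (add_zero _) using 1
  · exact (hf₁.sub hf₂).congr_left fun ε => by ring

end Splitting

/-! ### Positivity of the capacitance matrix and symmetry of the system -/

namespace ResonatorChain

open scoped ComplexOrder

variable {N : ℕ} (D : ResonatorChain N)

theorem length_pos (i : Fin N) : 0 < D.length i := sub_pos.2 (D.left_lt_right i)

theorem gap_pos (i : Fin N) : 0 < D.gap i := by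
  rcases N with _ | n
  · exact i.elim0
  rw [gap, sub_pos]
  split_ifs with h
  · exact D.right_lt_left_add _ _
  · rw [add_zero]
    refine D.right_lt_left _ _ ?_
    have hi : i ≠ Fin.last n := fun hi => h (by rw [hi]; rfl)
    rw [Fin.lt_def, coe_finRotate_of_ne_last hi]
    exact Nat.lt_succ_self _

theorem conj_phase_mul_phase (α : ℝ) (i : Fin N) :
    (starRingEnd ℂ) (D.phase α i) * D.phase α i = 1 := by
  rw [phase]
  split_ifs
  · rw [← Complex.exp_conj, ← Complex.exp_add]
    simp
  · simp

/-- The quasiperiodic difference operator of the chain. -/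
noncomputable def difference (α : ℝ) : Matrix (Fin N) (Fin N) ℂ := Matrix.of fun i j =>
  (if i = j then 1 else 0) - if j = finRotate N i then D.phase α i else 0

/-- The factorization `∇* diag(1/g) ∇` rests on the phases being unimodular; it makes positive
semidefiniteness evident and covers small `N` uniformly. -/
theorem capacitance_eq (α : ℝ) : D.capacitance α = (D.difference α).conjTranspose *
    Matrix.diagonal (fun i => (((D.gap i)⁻¹ : ℝ) : ℂ)) * D.difference α := by
  ext i j
  rw [Matrix.mul_apply]
  simp only [Matrix.mul_diagonal, Matrix.conjTranspose_apply, difference, Matrix.of_apply,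
    capacitance]
  have h : ∀ k, star ((if k = i then (1 : ℂ) else 0) -
        if i = finRotate N k then D.phase α k else 0) * (((D.gap k)⁻¹ : ℝ) : ℂ) *
      ((if k = j then 1 else 0) - if j = finRotate N k then D.phase α k else 0) =
      (if k = i then (if i = j then (((D.gap i)⁻¹ : ℝ) : ℂ) else 0) else 0)
      - (if k = i then
          (if j = finRotate N i then D.phase α i * (((D.gap i)⁻¹ : ℝ) : ℂ) else 0) else 0)
      - (if k = j then (if i = finRotate N j then
          (starRingEnd ℂ) (D.phase α j) * (((D.gap j)⁻¹ : ℝ) : ℂ) else 0) else 0)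
      + (if k = (finRotate N).symm i then
          (if i = j then (((D.gap ((finRotate N).symm i))⁻¹ : ℝ) : ℂ) else 0) else 0) := by
    intro k
    have e1 : (k = (finRotate N).symm i) ↔ i = finRotate N k := by
      rw [Equiv.eq_symm_apply, eq_comm]
    have e2 : ((starRingEnd ℂ) (D.phase α k)) * D.phase α k = 1 := D.conj_phase_mul_phase α k
    have t1 : star ((if k = i then (1 : ℂ) else 0) -
        if i = finRotate N k then D.phase α k else 0) = (if k = i then (1 : ℂ) else 0) -
        if i = finRotate N k then (starRingEnd ℂ) (D.phase α k) else 0 := by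
      split_ifs <;> simp
    rw [t1]
    have t2 : (if k = (finRotate N).symm i then
          (if i = j then (((D.gap ((finRotate N).symm i))⁻¹ : ℝ) : ℂ) else 0) else 0) =
        (if i = finRotate N k then (((D.gap k)⁻¹ : ℝ) : ℂ) else 0) *
          (if j = finRotate N k then 1 else 0) := by
      by_cases h1 : k = (finRotate N).symm i
      · have h2 := e1.1 h1
        rw [if_pos h1, if_pos h2, ← h1, ← h2]
        by_cases h3 : i = j
        · simp [h3]
        · simp [h3, Ne.symm h3]
      · rw [if_neg h1, if_neg (fun h => h1 (e1.2 h)), zero_mul]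
    have t3 : (if k = i then (if i = j then (((D.gap i)⁻¹ : ℝ) : ℂ) else 0) else 0) =
        (if k = i then (((D.gap k)⁻¹ : ℝ) : ℂ) else 0) * (if k = j then 1 else 0) := by
      by_cases h1 : k = i
      · subst h1
        split_ifs <;> simp
      · simp [h1]
    have t4 : (if k = i then
          (if j = finRotate N i then D.phase α i * (((D.gap i)⁻¹ : ℝ) : ℂ) else 0) else 0) =
        (if k = i then (((D.gap k)⁻¹ : ℝ) : ℂ) else 0) *
          (if j = finRotate N k then D.phase α k else 0) := by
      by_cases h1 : k = i
      · subst h1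
        split_ifs <;> simp [mul_comm]
      · simp [h1]
    have t5 : (if k = j then (if i = finRotate N j then
          (starRingEnd ℂ) (D.phase α j) * (((D.gap j)⁻¹ : ℝ) : ℂ) else 0) else 0) =
        (if k = j then 1 else 0) * (((D.gap k)⁻¹ : ℝ) : ℂ) *
          (if i = finRotate N k then (starRingEnd ℂ) (D.phase α k) else 0) := by
      by_cases h1 : k = j
      · subst h1
        split_ifs <;> simp [mul_comm]
      · simp [h1]
    rw [t2, t3, t4, t5]
    split_ifs <;> first
      | ring1
      | linear_combination (((D.gap k)⁻¹ : ℝ) : ℂ) * e2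
  rw [Finset.sum_congr rfl fun k _ => h k]
  simp only [Finset.sum_add_distrib, Finset.sum_sub_distrib, Finset.sum_ite_eq',
    Finset.mem_univ, if_true, Complex.ofReal_add]
  split_ifs <;> ring

theorem posSemidef_capacitance (α : ℝ) : (D.capacitance α).PosSemidef := by
  rw [capacitance_eq]
  refine Matrix.PosSemidef.conjTranspose_mul_mul_same (Matrix.PosSemidef.diagonal fun i => ?_) _
  exact Complex.zero_le_real.2 (inv_nonneg.2 (D.gap_pos i).le)

theorem isHermitian_capacitance (α : ℝ) : (D.capacitance α).IsHermitian :=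
  (D.posSemidef_capacitance α).isHermitian

/-- The diagonal entries of `W₃`. -/
noncomputable def modulationTerm (κ : ℝ → ℝ) (t : ℝ) : ℝ :=
  √(κ t) / 2 * deriv (fun s => deriv κ s / κ s ^ (3 / 2 : ℝ)) t

theorem secondOrderMatrix_apply (α δ κr ρr : ℝ) (κ : Fin N → ℝ → ℝ) (t : ℝ) (i j : Fin N) :
    D.secondOrderMatrix α δ κr ρr κ t i j =
      ((δ * κr / ρr * (√(κ i t) / D.length i) * √(κ j t) : ℝ) : ℂ) * D.capacitance α i j +
        if i = j then (modulationTerm (κ i) t : ℂ) else 0 := by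
  rw [secondOrderMatrix, Matrix.add_apply, Matrix.smul_apply, Matrix.mul_diagonal,
    Matrix.diagonal_mul, Matrix.diagonal_apply, smul_eq_mul]
  congr 1
  push_cast
  ring

theorem length_mul_secondOrderMatrix_apply (α δ κr ρr : ℝ) (κ : Fin N → ℝ → ℝ) (t : ℝ)
    (i j : Fin N) : (D.length i : ℂ) * D.secondOrderMatrix α δ κr ρr κ t i j =
      ((δ * κr / ρr * √(κ i t) * √(κ j t) : ℝ) : ℂ) * D.capacitance α i j +
        if i = j then ((D.length i * modulationTerm (κ i) t : ℝ) : ℂ) else 0 := by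
  have h : (D.length i : ℂ) ≠ 0 := by exact_mod_cast (D.length_pos i).ne'
  rw [secondOrderMatrix_apply, mul_add]
  congr 1
  · push_cast
    field_simp
  · split_ifs <;> simp

/-- `diag(ℓ) M` is Hermitian. -/
theorem conj_length_mul_secondOrderMatrix (α δ κr ρr : ℝ) (κ : Fin N → ℝ → ℝ) (t : ℝ)
    (i j : Fin N) :
    (starRingEnd ℂ) ((D.length i : ℂ) * D.secondOrderMatrix α δ κr ρr κ t i j) =
      (D.length j : ℂ) * D.secondOrderMatrix α δ κr ρr κ t j i := by
  rw [length_mul_secondOrderMatrix_apply, length_mul_secondOrderMatrix_apply, map_add, map_mul,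
    Complex.conj_ofReal, ← (D.isHermitian_capacitance α).apply j i]
  congr 1
  · rw [show (starRingEnd ℂ) (D.capacitance α i j) = star (D.capacitance α i j) from rfl]
    push_cast
    ring
  · by_cases h : i = j
    · subst h
      simp only [if_true, Complex.conj_ofReal]
    · simp [h, Ne.symm h]

end ResonatorChain

/-! ### The modulation term and the rigidity of coupled moduli -/

section Modulation

open ResonatorChain

theorem ContDiff.hasDerivAt_deriv_deriv {f : ℝ → ℝ} (hf : ContDiff ℝ 2 f) (t : ℝ) :
    HasDerivAt (deriv f) (deriv (deriv f) t) t :=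
  (((contDiff_succ_iff_deriv (n := 1)).1 hf).2.2.differentiable (by norm_num) t).hasDerivAt

theorem modulationTerm_eq {κ : ℝ → ℝ} (hκ : ContDiff ℝ 2 κ) (hpos : ∀ t, 0 < κ t) (t : ℝ) :
    modulationTerm κ t = deriv (deriv κ) t / κ t / 2 - 3 / 4 * (deriv κ t / κ t) ^ 2 := by
  have h1 : HasDerivAt κ (deriv κ t) t :=
    (hκ.differentiable (by norm_num) t).hasDerivAt
  have h2 : HasDerivAt (deriv κ) (deriv (deriv κ) t) t :=
    hκ.hasDerivAt_deriv_deriv t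
  have hx := hpos t
  have h3 := h1.rpow_const (p := (3 / 2 : ℝ)) (Or.inl hx.ne')
  have h4 := h2.fun_div h3 (Real.rpow_pos_of_pos hx _).ne'
  rw [modulationTerm, h4.deriv]
  have e1 : κ t ^ (3 / 2 : ℝ) = κ t * √(κ t) := by
    rw [Real.sqrt_eq_rpow, ← Real.rpow_one_add' hx.le (by norm_num)]
    norm_num
  have e2 : κ t ^ ((3 / 2 : ℝ) - 1) = √(κ t) := by
    rw [Real.sqrt_eq_rpow]
    norm_num
  rw [e1, e2]
  have h5 : 0 < √(κ t) := Real.sqrt_pos.2 hx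
  have h6 : √(κ t) ^ 2 = κ t := Real.sq_sqrt hx.le
  set r := √(κ t)
  rw [← h6]
  field_simp
  ring

/-- A negative second derivative would make the minimum a local maximum too, hence `f` locally
constant, with second derivative zero. -/
theorem deriv_deriv_nonneg_of_isMinOn {f : ℝ → ℝ} {t₀ : ℝ} (hf : ContinuousAt f t₀)
    (hmin : ∀ t, f t₀ ≤ f t) : 0 ≤ deriv (deriv f) t₀ := by
  by_contra hc
  push Not at hc
  have hloc : IsLocalMin f t₀ := Eventually.of_forall hmin
  have hmax := isLocalMax_of_deriv_deriv_neg hc hloc.deriv_eq_zero hf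
  have heq : f =ᶠ[𝓝 t₀] fun _ => f t₀ := by
    filter_upwards [hmax] with t ht
    exact le_antisymm ht (hmin t)
  have := heq.deriv.deriv_eq
  simp [deriv_const'] at this
  linarith

theorem modulationTerm_nonneg_of_isMinOn {κ : ℝ → ℝ} (hκ : ContDiff ℝ 2 κ)
    (hpos : ∀ t, 0 < κ t) {t₀ : ℝ} (hmin : ∀ t, κ t₀ ≤ κ t) : 0 ≤ modulationTerm κ t₀ := by
  have hloc : IsLocalMin κ t₀ := Eventually.of_forall hmin
  have h1 := deriv_deriv_nonneg_of_isMinOn hκ.continuous.continuousAt hmin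
  have h2 := hpos t₀
  rw [modulationTerm_eq hκ hpos, hloc.deriv_eq_zero]
  simp only [zero_div, ne_eq, OfNat.ofNat_ne_zero, not_false_eq_true, zero_pow, mul_zero, sub_zero]
  positivity

theorem Function.Periodic.exists_forall_le_of_continuous {f : ℝ → ℝ} {T : ℝ} (hT : 0 < T)
    (hf : Function.Periodic f T) (hc : Continuous f) : ∃ t₀, ∀ t, f t₀ ≤ f t := by
  obtain ⟨t₀, -, h⟩ := (isCompact_Icc (a := (0 : ℝ)) (b := T)).exists_isMinOn
    ⟨0, Set.left_mem_Icc.2 hT.le⟩ hc.continuousOn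
  refine ⟨t₀, fun t => ?_⟩
  obtain ⟨y, hy, hty⟩ := hf.exists_mem_Ico₀ hT t
  rw [hty]
  exact h (Set.Ico_subset_Icc_self hy)

/-- Two moduli with constant product have modulation terms adding up to a nonpositive quantity. -/
theorem modulationTerm_add_modulationTerm {κ κ' : ℝ → ℝ} (hκ : ContDiff ℝ 2 κ)
    (hκ' : ContDiff ℝ 2 κ') (hpos : ∀ t, 0 < κ t) (hpos' : ∀ t, 0 < κ' t) {k : ℝ}
    (hk : ∀ t, κ t * κ' t = k) (t : ℝ) :
    modulationTerm κ t + modulationTerm κ' t = -(1 / 2) * (deriv κ t / κ t) ^ 2 := by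
  have d1 (s : ℝ) : HasDerivAt κ (deriv κ s) s := (hκ.differentiable (by norm_num) s).hasDerivAt
  have d1' (s : ℝ) : HasDerivAt κ' (deriv κ' s) s :=
    (hκ'.differentiable (by norm_num) s).hasDerivAt
  have d2 : HasDerivAt (deriv κ) (deriv (deriv κ) t) t :=
    hκ.hasDerivAt_deriv_deriv t
  have d2' : HasDerivAt (deriv κ') (deriv (deriv κ') t) t :=
    hκ'.hasDerivAt_deriv_deriv t
  have e1 (s : ℝ) : deriv κ s * κ' s + κ s * deriv κ' s = 0 := by
    have h := (d1 s).fun_mul (d1' s)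
    simp only [hk] at h
    exact h.unique (hasDerivAt_const s k)
  have e2 : (deriv (deriv κ) t * κ' t + deriv κ t * deriv κ' t) +
      (deriv κ t * deriv κ' t + κ t * deriv (deriv κ') t) = 0 := by
    have h := (d2.fun_mul (d1' t)).fun_add ((d1 t).fun_mul d2')
    simp only [e1] at h
    exact h.unique (hasDerivAt_const t 0)
  -- With `y = log κ` the modulation term is `y''/2 - y'²/4`. Passing to the other modulus replaces
  -- `y` by a constant minus `y`, so the second derivatives cancel in the sum.
  rw [modulationTerm_eq hκ hpos, modulationTerm_eq hκ' hpos']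
  have hx := hpos t
  have hy := hpos' t
  have e3 : deriv κ' t / κ' t = -(deriv κ t / κ t) := by
    field_simp
    linarith [e1 t]
  have e4 : deriv (deriv κ) t / κ t + deriv (deriv κ') t / κ' t =
      2 * (deriv κ t / κ t) ^ 2 := by
    have : deriv (deriv κ) t / κ t + deriv (deriv κ') t / κ' t =
        -(2 * (deriv κ t / κ t) * (deriv κ' t / κ' t)) := by
      field_simp
      linarith
    rw [this, e3]
    ring
  rw [e3]
  linear_combination (1 / 2) * e4

/-- If the static matrix does not depend on time, two coupled moduli are constant. -/
theorem eq_of_coupled {κ κ' : ℝ → ℝ} (hκ : ContDiff ℝ 2 κ)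
    (hκ' : ContDiff ℝ 2 κ') (hpos : ∀ t, 0 < κ t) (hpos' : ∀ t, 0 < κ' t) {T : ℝ} (hT : 0 < T)
    (hper : Function.Periodic κ T) {k : ℝ} (hk : ∀ t, κ t * κ' t = k) {a a' m m' : ℝ}
    (ha : 0 ≤ a) (h : ∀ t, a * κ t + modulationTerm κ t = m)
    (h' : ∀ t, a' * κ' t + modulationTerm κ' t = m') (s t : ℝ) : κ s = κ t := by
  obtain ⟨t₀, h₀⟩ := hper.exists_forall_le_of_continuous hT hκ.continuous
  obtain ⟨t₁, h₁⟩ := Function.Periodic.exists_forall_le_of_continuous (f := fun t => -κ t) hT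
    (fun t => by simp [hper t]) hκ.continuous.neg
  have hd₀ : deriv κ t₀ = 0 := IsLocalMin.deriv_eq_zero (Eventually.of_forall h₀)
  have hd₁ : deriv κ t₁ = 0 :=
    IsLocalMax.deriv_eq_zero (Eventually.of_forall fun t => neg_le_neg_iff.1 (h₁ t))
  -- The sum of the two relations, multiplied by `κ`: a quadratic polynomial in `κ` equals a
  -- nonnegative multiple of `κ̇²`. It vanishes at the minimum and the maximum of `κ`.
  have hq (t : ℝ) : a * κ t ^ 2 - (m + m') * κ t + a' * k =
      1 / 2 * (deriv κ t / κ t) ^ 2 * κ t := by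
    have h1 := modulationTerm_add_modulationTerm hκ hκ' hpos hpos' hk t
    rw [← hk t, ← h t, ← h' t]
    linear_combination (-κ t) * h1
  have hq₀ := hq t₀
  have hq₁ := hq t₁
  rw [hd₀] at hq₀
  rw [hd₁] at hq₁
  simp only [zero_div, ne_eq, OfNat.ofNat_ne_zero, not_false_eq_true, zero_pow, mul_zero,
    zero_mul] at hq₀ hq₁
  rcases (h₀ t₁).eq_or_lt with heq | hlt
  · have hconst (t : ℝ) : κ t = κ t₀ :=
      le_antisymm (by rw [heq]; exact neg_le_neg_iff.1 (h₁ t)) (h₀ t)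
    rw [hconst s, hconst t]
  · refine is_const_of_deriv_eq_zero (hκ.differentiable (by norm_num)) (fun t => ?_) s t
    have hle₁ : κ t ≤ κ t₁ := neg_le_neg_iff.1 (h₁ t)
    have hx := hpos t
    -- A quadratic with leading coefficient `a ≥ 0` and two distinct zeros is nonpositive between
    -- them. The opposite sign from `hq` forces `κ̇ = 0`.
    have h2 : (κ t₁ - κ t₀) * (1 / 2 * (deriv κ t / κ t) ^ 2 * κ t) =
        -(a * (κ t₁ - κ t₀) * (κ t - κ t₀) * (κ t₁ - κ t)) := by
      rw [← hq t]
      linear_combination (κ t₁ - κ t) * hq₀ + (κ t - κ t₀) * hq₁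
    have h3 : 0 ≤ a * (κ t₁ - κ t₀) * (κ t - κ t₀) * (κ t₁ - κ t) :=
      mul_nonneg (mul_nonneg (mul_nonneg ha (sub_nonneg.2 hlt.le)) (sub_nonneg.2 (h₀ t)))
        (sub_nonneg.2 hle₁)
    have h4 : 0 ≤ 1 / 2 * (deriv κ t / κ t) ^ 2 * κ t := by positivity
    have h5 : 1 / 2 * (deriv κ t / κ t) ^ 2 * κ t = 0 := by
      refine le_antisymm ?_ h4
      by_contra hc
      push Not at hc
      have := mul_pos (sub_pos.2 hlt) hc
      linarith
    have h6 : deriv κ t / κ t = 0 := by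
      have : (deriv κ t / κ t) ^ 2 = 0 := by
        rcases mul_eq_zero.1 h5 with h | h
        · linarith
        · exact absurd h hx.ne'
      exact pow_eq_zero_iff two_ne_zero |>.1 this
    exact (div_eq_zero_iff.1 h6).resolve_right hx.ne'

end Modulation

/-! ### Positivity of a time independent second order matrix -/

namespace ResonatorChain

open scoped ComplexOrder

variable {N : ℕ} (D : ResonatorChain N)

theorem capacitance_diag_eq_re (α : ℝ) (i : Fin N) :
    D.capacitance α i i = ((D.capacitance α i i).re : ℂ) :=
  Complex.eq_re_of_ofReal_le (r := 0) (by simpa using (D.posSemidef_capacitance α).diag_nonneg)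

theorem capacitance_diag_re_nonneg (α : ℝ) (i : Fin N) : 0 ≤ (D.capacitance α i i).re :=
  (Complex.le_def.1 (D.posSemidef_capacitance α).diag_nonneg).1

/-- If `M(t)` does not depend on time, then `diag(ℓ) M` is positive semidefinite. -/
theorem posSemidef_length_mul_secondOrderMatrix {α δ κr ρr : ℝ} {κ : Fin N → ℝ → ℝ} {T : ℝ}
    (hT : 0 < T) (hδ : 0 < δ) (hκr : 0 < κr) (hρr : 0 < ρr) (hpos : ∀ i t, 0 < κ i t)
    (hsmooth : ∀ i, ContDiff ℝ 2 (κ i)) (hper : ∀ i, Function.Periodic (κ i) T)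
    {M : Matrix (Fin N) (Fin N) ℂ} (hM : ∀ t, D.secondOrderMatrix α δ κr ρr κ t = M) :
    (Matrix.diagonal (fun i => (D.length i : ℂ)) * M).PosSemidef := by
  have hc : 0 < δ * κr / ρr := by positivity
  set c := δ * κr / ρr
  choose τ hτ using fun i => (hper i).exists_forall_le_of_continuous hT (hsmooth i).continuous
  have hentry (t : ℝ) (i j : Fin N) : (D.length i : ℂ) * M i j =
      ((c * √(κ i t) * √(κ j t) : ℝ) : ℂ) * D.capacitance α i j +
        if i = j then ((D.length i * modulationTerm (κ i) t : ℝ) : ℂ) else 0 := by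
    rw [← hM t, length_mul_secondOrderMatrix_apply]
  have hdiag (i : Fin N) (t : ℝ) : c * (D.capacitance α i i).re / D.length i * κ i t +
      modulationTerm (κ i) t = (M i i).re := by
    have h := hentry t i i
    have hl := D.length_pos i
    rw [if_pos rfl, capacitance_diag_eq_re, mul_assoc c, Real.mul_self_sqrt (hpos i t).le] at h
    have h1 := congrArg Complex.re h
    rw [Complex.re_ofReal_mul, ← Complex.ofReal_mul, ← Complex.ofReal_add, Complex.ofReal_re] at h1
    field_simp
    linarith
  -- A nonzero coupling makes `κ i * κ j` constant, because the off-diagonal entry of `M` is; the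
  -- diagonal entries give the two relations of `eq_of_coupled`.
  have hconst (i j : Fin N) (hij : i ≠ j) (hC : D.capacitance α i j ≠ 0) (s t : ℝ) :
      κ i s = κ i t := by
    have hk (t : ℝ) : κ i t * κ j t = κ i 0 * κ j 0 := by
      have h := (hentry t i j).symm.trans (hentry 0 i j)
      simp only [if_neg hij, add_zero] at h
      have h1 := Complex.ofReal_injective (mul_right_cancel₀ hC h)
      rw [mul_assoc, mul_assoc] at h1
      have h2 := mul_left_cancel₀ hc.ne' h1
      rw [← Real.sqrt_mul (hpos i t).le, ← Real.sqrt_mul (hpos i 0).le] at h2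
      exact (Real.sqrt_inj (mul_pos (hpos i t) (hpos j t)).le
        (mul_pos (hpos i 0) (hpos j 0)).le).1 h2
    exact eq_of_coupled (hsmooth i) (hsmooth j) (hpos i) (hpos j) hT (hper i) hk
      (div_nonneg (mul_nonneg hc.le (D.capacitance_diag_re_nonneg α i)) (D.length_pos i).le)
      (hdiag i) (hdiag j) s t
  -- Each resonator may be evaluated at its own time `τ i`, as only constant moduli enter the
  -- nonzero off-diagonal entries. At the minimum `τ i` of `κ i` the contribution of `W₃` is
  -- nonnegative.
  have heq : Matrix.diagonal (fun i => (D.length i : ℂ)) * M =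
      (Matrix.diagonal fun i => ((√(κ i (τ i)) : ℝ) : ℂ)).conjTranspose *
        ((c : ℂ) • D.capacitance α) * (Matrix.diagonal fun i => ((√(κ i (τ i)) : ℝ) : ℂ)) +
      Matrix.diagonal fun i => ((D.length i * modulationTerm (κ i) (τ i) : ℝ) : ℂ) := by
    ext i j
    rw [Matrix.diagonal_mul, Matrix.add_apply, Matrix.mul_diagonal, Matrix.diagonal_conjTranspose,
      Matrix.diagonal_mul, Matrix.smul_apply, Matrix.diagonal_apply, Pi.star_apply,
      show star ((√(κ i (τ i)) : ℝ) : ℂ) = ((√(κ i (τ i)) : ℝ) : ℂ) from Complex.conj_ofReal _,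
      smul_eq_mul]
    by_cases hij : i = j
    · subst hij
      rw [hentry (τ i)]
      simp only [if_true]
      push_cast
      ring
    · rw [hentry 0, if_neg hij, if_neg hij]
      by_cases hC : D.capacitance α i j = 0
      · simp [hC]
      · have hC' : D.capacitance α j i ≠ 0 := by
          rw [← (D.isHermitian_capacitance α).apply j i]
          exact star_ne_zero.2 hC
        rw [hconst i j hij hC 0 (τ i), hconst j i (Ne.symm hij) hC' 0 (τ j)]
        push_cast
        ring
  rw [heq]
  refine Matrix.PosSemidef.add (Matrix.PosSemidef.conjTranspose_mul_mul_same ?_ _)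
    (Matrix.PosSemidef.diagonal fun i => Complex.zero_le_real.2 ?_)
  · exact (D.posSemidef_capacitance α).smul (Complex.zero_le_real.2 hc.le)
  · exact mul_nonneg (D.length_pos i).le
      (modulationTerm_nonneg_of_isMinOn (hsmooth i) (hpos i) (hτ i))

end ResonatorChain

/-! ### The invariant Krein form -/

namespace ResonatorChain

variable {N : ℕ} (D : ResonatorChain N)

/-- The skew-Hermitian form preserved by the capacitance system. -/
noncomputable def kreinForm : Matrix (Fin N ⊕ Fin N) (Fin N ⊕ Fin N) ℂ :=
  Matrix.fromBlocks 0 (Matrix.diagonal fun i => (D.length i : ℂ))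
    (-Matrix.diagonal fun i => (D.length i : ℂ)) 0

theorem conjTranspose_length_mul_secondOrderMatrix (α δ κr ρr : ℝ) (κ : Fin N → ℝ → ℝ) (t : ℝ) :
    (D.secondOrderMatrix α δ κr ρr κ t).conjTranspose *
        Matrix.diagonal (fun i => (D.length i : ℂ)) =
      Matrix.diagonal (fun i => (D.length i : ℂ)) * D.secondOrderMatrix α δ κr ρr κ t := by
  ext i j
  have h := D.conj_length_mul_secondOrderMatrix α δ κr ρr κ t j i
  rw [Matrix.mul_diagonal, Matrix.diagonal_mul, ← h, map_mul, Complex.conj_ofReal, mul_comm]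
  rfl

theorem firstOrderMatrix_kreinForm (α δ κr ρr : ℝ) (κ : Fin N → ℝ → ℝ) (t : ℝ) :
    (D.firstOrderMatrix α δ κr ρr κ t).conjTranspose * D.kreinForm +
      D.kreinForm * D.firstOrderMatrix α δ κr ρr κ t = 0 := by
  rw [firstOrderMatrix, kreinForm, Matrix.fromBlocks_conjTranspose, Matrix.fromBlocks_multiply,
    Matrix.fromBlocks_multiply, Matrix.fromBlocks_add]
  have h := D.conjTranspose_length_mul_secondOrderMatrix α δ κr ρr κ t
  generalize Matrix.diagonal (fun i => (D.length i : ℂ)) = L at h ⊢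
  simp [h]

theorem sum_star_mul_length_mul (v : Fin N → ℂ) :
    ∑ i, star (v i) * (D.length i : ℂ) * v i =
      ((∑ i, D.length i * ‖v i‖ ^ 2 : ℝ) : ℂ) := by
  rw [Complex.ofReal_sum]
  refine Finset.sum_congr rfl fun i _ => ?_
  rw [mul_right_comm, mul_comm, show star (v i) = (starRingEnd ℂ) (v i) from rfl,
    Complex.conj_mul']
  push_cast
  ring

theorem sum_length_mul_norm_sq_pos {v : Fin N → ℂ} (hv : v ≠ 0) :
    0 < ∑ i, D.length i * ‖v i‖ ^ 2 := by
  obtain ⟨i, hi⟩ := Function.ne_iff.1 hv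
  refine Finset.sum_pos' (fun j _ => mul_nonneg (D.length_pos j).le (by positivity))
    ⟨i, Finset.mem_univ i, mul_pos (D.length_pos i) (pow_pos (norm_pos_iff.2 hi) 2)⟩

end ResonatorChain

/-! ### Krein signature of the static modes and the symmetry of the Fourier coefficients -/

section ResonatorSystem

open scoped ComplexOrder

theorem intervalIntegral_conj (f : ℝ → ℂ) (a b : ℝ) :
    ∫ t in a..b, (starRingEnd ℂ) (f t) = (starRingEnd ℂ) (∫ t in a..b, f t) := by
  rw [intervalIntegral, intervalIntegral, map_sub, integral_conj, integral_conj]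

variable {ι : Type*} {Ω ε₀ : ℝ}

/-- Conjugation turns `e^{-iΩmt}` into `e^{iΩmt}`, whence the index `-m`. -/
theorem matrixFourierCoeff_relation {G : ℝ → Matrix ι ι ℂ} {p q : ι} {a b : ℂ}
    (h : ∀ t, a * G t p q = b * (starRingEnd ℂ) (G t q p)) (m : ℤ) :
    a * matrixFourierCoeff Ω G m p q =
      b * (starRingEnd ℂ) (matrixFourierCoeff Ω G (-m) q p) := by
  simp only [matrixFourierCoeff, Matrix.of_apply, map_mul, Complex.conj_ofReal]
  rw [mul_left_comm, mul_left_comm b]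
  refine congrArg _ ?_
  rw [← intervalIntegral_conj, ← intervalIntegral.integral_const_mul a,
    ← intervalIntegral.integral_const_mul b]
  refine intervalIntegral.integral_congr fun t _ => ?_
  change a * (G t p q * _) = b * (starRingEnd ℂ) _
  rw [map_mul, ← mul_assoc, ← mul_assoc, h t, ← Complex.exp_conj]
  congr 2
  simp only [map_neg, map_mul, Complex.conj_I, Complex.conj_ofReal]
  push_cast
  ring

variable [DecidableEq ι] {A : ℝ → ℝ → Matrix ι ι ℂ} {Ac : ℕ → ℝ → Matrix ι ι ℂ} {d : ι → ℂ}

theorem IsModulatedSystem.static_eq (hε₀ : 0 < ε₀) (hA : IsModulatedSystem Ω ε₀ A Ac d) (t : ℝ) :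
    A 0 t = Matrix.diagonal d := by
  ext i j
  have h1 := hA.hasSum 0 (by simpa using hε₀) t i j
  have h2 : HasSum (fun n => (((0 : ℝ) : ℂ)) ^ n * Ac n t i j) (Ac 0 t i j) := by
    convert hasSum_single 0 fun n hn => ?_ using 1
    · simp
    · simp [hn]
  rw [h1.unique h2, hA.static]

variable [Fintype ι]

/-- An invariant sesquilinear form of the system is also invariant under the first order
coefficient. -/
theorem IsModulatedSystem.coeff_one_form_eq_zero (hε₀ : 0 < ε₀)
    (hA : IsModulatedSystem Ω ε₀ A Ac d) {J : Matrix ι ι ℂ}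
    (hJ : ∀ ε : ℝ, |ε| < ε₀ → ∀ t, (A ε t).conjTranspose * J + J * A ε t = 0) (t : ℝ) :
    (Ac 1 t).conjTranspose * J + J * Ac 1 t = 0 := by
  ext i j
  have h1 : HasDerivAt (fun ε => ((A ε t).conjTranspose * J + J * A ε t) i j)
      (((Ac 1 t).conjTranspose * J + J * Ac 1 t) i j) 0 := by
    simp only [Matrix.add_apply, Matrix.mul_apply, Matrix.conjTranspose_apply]
    refine HasDerivAt.fun_add (HasDerivAt.fun_sum fun k _ => ?_) (HasDerivAt.fun_sum fun k _ => ?_)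
    · exact ((hA.hasDerivAt_entry hε₀ t k i).star).mul_const _
    · exact (hA.hasDerivAt_entry hε₀ t k j).const_mul _
  have h2 : (fun ε => ((A ε t).conjTranspose * J + J * A ε t) i j) =ᶠ[𝓝 0] fun _ => 0 := by
    filter_upwards [Metric.ball_mem_nhds (0 : ℝ) hε₀] with ε hε
    rw [hJ ε (by simpa using hε) t]
    rfl
  exact h1.unique ((hasDerivAt_const (0 : ℝ) (0 : ℂ)).congr_of_eventuallyEq h2)

/-- The static capacitance system is stable and the modes have a definite Krein signature. -/
theorem IsResonatorSystem.exists_form (hΩ : 0 < Ω) (hε₀ : 0 < ε₀)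
    (hA : IsModulatedSystem Ω ε₀ A Ac d) (hR : IsResonatorSystem Ω ε₀ A) :
    ∃ J : Matrix ι ι ℂ,
      (∀ ε : ℝ, |ε| < ε₀ → ∀ t, (A ε t).conjTranspose * J + J * A ε t = 0) ∧
      (∀ j, J j j ≠ 0) ∧ ∀ i j, d i ≠ d j → J i j = 0 := by
  obtain ⟨N, D, α, δ, κr, ρr, κ, S, S', hδ, hκr, hρr, hSS', hS'S, h⟩ := hR
  have hform (ε : ℝ) (hε : |ε| < ε₀) (t : ℝ) :
      (A ε t).conjTranspose * (S.conjTranspose * D.kreinForm * S) +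
        (S.conjTranspose * D.kreinForm * S) * A ε t = 0 := by
    rw [(h ε hε).2 t]
    set G := D.firstOrderMatrix α δ κr ρr (κ ε) t
    have h1 : (S' * G * S).conjTranspose * (S.conjTranspose * D.kreinForm * S) =
        S.conjTranspose * (G.conjTranspose * D.kreinForm) * S := by
      have : S'.conjTranspose * S.conjTranspose = 1 := by
        rw [← Matrix.conjTranspose_mul, hSS', Matrix.conjTranspose_one]
      simp only [Matrix.conjTranspose_mul, Matrix.mul_assoc]
      rw [← Matrix.mul_assoc S'.conjTranspose, this, Matrix.one_mul]
    have h2 : (S.conjTranspose * D.kreinForm * S) * (S' * G * S) =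
        S.conjTranspose * (D.kreinForm * G) * S := by
      simp only [Matrix.mul_assoc]
      rw [← Matrix.mul_assoc S S', hSS', Matrix.one_mul]
    rw [h1, h2, ← Matrix.add_mul, ← Matrix.mul_add, D.firstOrderMatrix_kreinForm, Matrix.mul_zero,
      Matrix.zero_mul]
  have h00 : |(0 : ℝ)| < ε₀ := by simpa using hε₀
  have hG (t : ℝ) : D.firstOrderMatrix α δ κr ρr (κ 0) t * S = S * Matrix.diagonal d := by
    rw [← hA.static_eq hε₀ t, (h 0 h00).2 t, ← Matrix.mul_assoc, ← Matrix.mul_assoc, hSS',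
      Matrix.one_mul]
  have hM (t : ℝ) : D.secondOrderMatrix α δ κr ρr (κ 0) t =
      D.secondOrderMatrix α δ κr ρr (κ 0) 0 := by
    have h1 : D.firstOrderMatrix α δ κr ρr (κ 0) t = D.firstOrderMatrix α δ κr ρr (κ 0) 0 := by
      have := congrArg (· * S') ((hG t).trans (hG 0).symm)
      simpa only [Matrix.mul_assoc, hSS', Matrix.mul_one] using this
    exact neg_injective (Matrix.fromBlocks_inj.1 h1).2.2.1
  set M := D.secondOrderMatrix α δ κr ρr (κ 0) 0
  have hpsd := D.posSemidef_length_mul_secondOrderMatrix (T := 2 * Real.pi / Ω) (by positivity)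
    hδ hκr hρr (fun i t => ((h 0 h00).1 i).1 t) (fun i => ((h 0 h00).1 i).2.1)
    (fun i => ((h 0 h00).1 i).2.2) hM
  -- the columns of `S` are the modes `(v, d v)` with `M v = - d² v`
  set v : ι → Fin N → ℂ := fun j i => S (Sum.inl i) j with hv
  have hlower (j : ι) (i : Fin N) : S (Sum.inr i) j = d j * v j i := by
    have h1 := congrFun (congrFun (hG 0) (Sum.inl i)) j
    rw [Matrix.mul_diagonal, Matrix.mul_apply, Fintype.sum_sum_type] at h1
    simpa [ResonatorChain.firstOrderMatrix, Matrix.one_apply, mul_comm] using h1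
  have heigen (j : ι) : M.mulVec (v j) = -(d j ^ 2) • v j := by
    funext i
    have h1 := congrFun (congrFun (hG 0) (Sum.inr i)) j
    rw [Matrix.mul_diagonal, Matrix.mul_apply, Fintype.sum_sum_type] at h1
    simp only [ResonatorChain.firstOrderMatrix, Matrix.fromBlocks_apply₂₁,
      Matrix.fromBlocks_apply₂₂, Matrix.neg_apply, Matrix.zero_apply, zero_mul,
      Finset.sum_const_zero, add_zero, neg_mul, Finset.sum_neg_distrib, hlower] at h1
    rw [Matrix.mulVec, dotProduct, Pi.smul_apply, smul_eq_mul]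
    linear_combination -h1
  have hv0 (j : ι) : v j ≠ 0 := by
    intro h0
    have h1 : ∀ x, S x j = 0 := by
      rintro (i | i)
      · exact congrFun h0 i
      · rw [hlower, h0, Pi.zero_apply, mul_zero]
    have h2 := congrFun (congrFun hS'S j) j
    rw [Matrix.mul_apply, Matrix.one_apply_eq] at h2
    simp [h1] at h2
  -- The Rayleigh quotient of the positive semidefinite `diag(ℓ) M` at `v j` is `-d j ^ 2`, so `d j`
  -- is imaginary.
  have hsq (j : ι) : ∃ r : ℝ, 0 ≤ r ∧ d j ^ 2 = -(r : ℂ) := by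
    have h1 := hpsd.dotProduct_mulVec_nonneg (v j)
    have hn := D.sum_length_mul_norm_sq_pos (hv0 j)
    set n := ∑ i, D.length i * ‖v j i‖ ^ 2 with hn_def
    have h2 : star (v j) ⬝ᵥ (Matrix.diagonal (fun i => (D.length i : ℂ)) * M).mulVec (v j) =
        -(d j ^ 2) * (n : ℂ) := by
      rw [← Matrix.mulVec_mulVec, heigen, Matrix.mulVec_smul, dotProduct_smul, smul_eq_mul, hn_def,
        ← D.sum_star_mul_length_mul]
      congr 1
      simp [dotProduct, Matrix.mulVec_diagonal, mul_assoc]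
    rw [h2] at h1
    obtain ⟨x, hx, hx'⟩ : ∃ x : ℝ, 0 ≤ x ∧ (x : ℂ) = -(d j ^ 2) * (n : ℂ) :=
      ⟨_, (Complex.le_def.1 h1).1, (Complex.eq_re_of_ofReal_le (r := 0) (by simpa using h1)).symm⟩
    refine ⟨x / n, div_nonneg hx hn.le, ?_⟩
    have hn' : (n : ℂ) ≠ 0 := by exact_mod_cast hn.ne'
    push_cast
    field_simp
    linear_combination hx'
  have him (j : ι) : (starRingEnd ℂ) (d j) = -d j := by
    obtain ⟨r, hr, hd⟩ := hsq j
    have h1 := congrArg Complex.re hd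
    have h2 := congrArg Complex.im hd
    simp only [sq, Complex.mul_re, Complex.mul_im, Complex.neg_re, Complex.neg_im,
      Complex.ofReal_re, Complex.ofReal_im, neg_zero] at h1 h2
    have h3 : (d j).re = 0 := by
      by_contra hre
      have h4 : (d j).im = 0 := by
        have : (d j).re * (d j).im = 0 := by linarith
        exact (mul_eq_zero.1 this).resolve_left hre
      rw [h4] at h1
      have := mul_self_pos.2 hre
      linarith
    apply Complex.ext <;> simp [h3]
  -- If `d j = 0`, the vector `(0, v)` would be mapped to the null vector `(v, 0)`: a Jordan chain,
  -- excluded by diagonalizability.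
  have hd0 (j : ι) : d j ≠ 0 := by
    intro h0
    have h1 : D.firstOrderMatrix α δ κr ρr (κ 0) 0 * (S * S') =
        S * Matrix.diagonal d * S' := by
      rw [← Matrix.mul_assoc, hG]
    have h2 : (S' * D.firstOrderMatrix α δ κr ρr (κ 0) 0).mulVec (Sum.elim 0 (v j)) =
        (Matrix.diagonal d).mulVec (S'.mulVec (Sum.elim 0 (v j))) := by
      rw [hSS', Matrix.mul_one] at h1
      rw [h1, Matrix.mulVec_mulVec, ← Matrix.mul_assoc, ← Matrix.mul_assoc, hS'S, Matrix.one_mul]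
    have h3 : (D.firstOrderMatrix α δ κr ρr (κ 0) 0).mulVec (Sum.elim 0 (v j)) =
        fun x => S x j := by
      rw [ResonatorChain.firstOrderMatrix, Matrix.fromBlocks_mulVec]
      funext x
      rcases x with i | i
      · simp [hv]
      · simp [hlower, h0]
    rw [← Matrix.mulVec_mulVec, h3] at h2
    have h4 := congrFun h2 j
    rw [Matrix.mulVec_diagonal, h0, zero_mul] at h4
    have h5 := congrFun (congrFun hS'S j) j
    rw [Matrix.one_apply_eq, Matrix.mul_apply] at h5
    rw [Matrix.mulVec, dotProduct, h5] at h4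
    exact one_ne_zero h4
  refine ⟨S.conjTranspose * D.kreinForm * S, hform, fun j hj => ?_, fun i j hij => ?_⟩
  · have h1 : (S.conjTranspose * D.kreinForm * S) j j =
        2 * d j * ((∑ i, D.length i * ‖v j i‖ ^ 2 : ℝ) : ℂ) := by
      rw [← D.sum_star_mul_length_mul, Matrix.mul_assoc, Matrix.mul_apply,
        Fintype.sum_sum_type]
      have e1 (i : Fin N) : (D.kreinForm * S) (Sum.inl i) j = D.length i * (d j * v j i) := by
        rw [Matrix.mul_apply, Fintype.sum_sum_type]
        simp [ResonatorChain.kreinForm, Matrix.diagonal_apply, hlower]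
      have e2 (i : Fin N) : (D.kreinForm * S) (Sum.inr i) j = -(D.length i * v j i) := by
        rw [Matrix.mul_apply, Fintype.sum_sum_type]
        simp [ResonatorChain.kreinForm, Matrix.diagonal_apply, hv]
      simp only [e1, e2, Matrix.conjTranspose_apply, hlower, ← Finset.sum_add_distrib,
        Finset.mul_sum]
      refine Finset.sum_congr rfl fun i _ => ?_
      rw [star_mul', show star (d j) = -d j from him j]
      change star (v j i) * _ + _ = _
      ring
    rw [h1] at hj
    have hn := D.sum_length_mul_norm_sq_pos (hv0 j)
    have hn' : ((∑ i, D.length i * ‖v j i‖ ^ 2 : ℝ) : ℂ) ≠ 0 := by exact_mod_cast hn.ne'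
    exact mul_ne_zero (mul_ne_zero two_ne_zero (hd0 j)) hn' hj
  · have h1 := congrFun (congrFun (hform 0 h00 0) i) j
    rw [hA.static_eq hε₀, Matrix.diagonal_conjTranspose, Matrix.add_apply, Matrix.diagonal_mul,
      Matrix.mul_diagonal, Pi.star_apply, show star (d i) = -d i from him i, Matrix.zero_apply] at h1
    -- As the `d i` are imaginary, invariance of the form at `ε = 0` makes modes with different `d`
    -- orthogonal.
    have h2 : (d j - d i) * (S.conjTranspose * D.kreinForm * S) i j = 0 := by
      linear_combination h1
    exact (mul_eq_zero.1 h2).resolve_left (sub_ne_zero.2 hij.symm)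

end ResonatorSystem

/-- If `d p ≠ d q`, rows and columns `p` and `q` of `J` have only their diagonal entries, since no
other `d k` folds to `f₀`. The `(p,q)` entry of the first order invariance relation then has just
two terms. -/
theorem IsResonatorSystem.firstCoeff_eq_zero_iff {ι : Type*} [Fintype ι] [DecidableEq ι]
    {Ω ε₀ : ℝ} (hΩ : 0 < Ω) (hε₀ : 0 < ε₀) {A : ℝ → ℝ → Matrix ι ι ℂ}
    {Ac : ℕ → ℝ → Matrix ι ι ℂ} {d : ι → ℂ} (hA : IsModulatedSystem Ω ε₀ A Ac d)
    (hR : IsResonatorSystem Ω ε₀ A) {f₀ : ℂ} {p q : ι}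
    (hf₀ : ∀ j, foldedEntry Ω d j = f₀ ↔ j = p ∨ j = q)
    (hA₁ : matrixFourierCoeff Ω (Ac 1) 0 = 0) {P : ℝ → ℝ → Matrix ι ι ℂ} {F : ℝ → Matrix ι ι ℂ}
    (hF : IsFloquetForm Ω A d P F) : firstCoeff F p q = 0 ↔ firstCoeff F q p = 0 := by
  have hp : foldedEntry Ω d p = f₀ := (hf₀ p).2 (Or.inl rfl)
  have hq : foldedEntry Ω d q = f₀ := (hf₀ q).2 (Or.inr rfl)
  rw [hF.firstCoeff_eq hΩ hε₀ hA (hp.trans hq.symm), hF.firstCoeff_eq hΩ hε₀ hA (hq.trans hp.symm)]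
  -- Equal entries have equal folding numbers, so both coefficients belong to `A₁^(0) = 0`.
  by_cases hd : d p = d q
  · simp [hd, hA₁]
  obtain ⟨J, hJ, hJ0, hJd⟩ := hR.exists_form hΩ hε₀ hA
  have hrel (t : ℝ) : J p p * Ac 1 t p q = -J q q * (starRingEnd ℂ) (Ac 1 t q p) := by
    have h1 := congrFun (congrFun (hA.coeff_one_form_eq_zero hε₀ hJ t) p) q
    rw [Matrix.add_apply, Matrix.mul_apply, Matrix.mul_apply, Matrix.zero_apply] at h1
    have hfold (k : ι) (hk : foldedEntry Ω d k ≠ f₀) : d k ≠ d p ∧ d k ≠ d q := by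
      constructor <;> rintro h
      · exact hk (by rw [← hp, foldedEntry, foldedEntry, h])
      · exact hk (by rw [← hq, foldedEntry, foldedEntry, h])
    rw [Finset.sum_eq_single q, Finset.sum_eq_single p] at h1
    · change (starRingEnd ℂ) (Ac 1 t q p) * _ + _ = _ at h1
      linear_combination h1
    · intro k _ hk
      rw [hJd p k, zero_mul]
      by_cases hkq : k = q
      · rwa [hkq]
      · exact (hfold k fun h => ((hf₀ k).1 h).elim hk hkq).1.symm
    · simp
    · intro k _ hk
      rw [hJd k q, mul_zero]
      by_cases hkp : k = p
      · rwa [hkp]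
      · exact (hfold k fun h => ((hf₀ k).1 h).elim hkp hk).2
    · simp
  have h2 := matrixFourierCoeff_relation (Ω := Ω) hrel
    (foldingNumber Ω (d p).im - foldingNumber Ω (d q).im)
  rw [neg_sub] at h2
  constructor
  · intro h
    rw [h, mul_zero, eq_comm, mul_eq_zero] at h2
    simpa using h2.resolve_left (neg_ne_zero.2 (hJ0 q))
  · intro h
    rw [h, map_zero, mul_zero, mul_eq_zero] at h2
    exact h2.resolve_left (hJ0 p)

theorem mainTheorem4 {ι : Type*} [Fintype ι] [DecidableEq ι]
    (Ω ε₀ : ℝ) (hΩ : 0 < Ω) (hε₀ : 0 < ε₀)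
    (A : ℝ → ℝ → Matrix ι ι ℂ) (Ac : ℕ → ℝ → Matrix ι ι ℂ) (d : ι → ℂ)
    (hA : IsModulatedSystem Ω ε₀ A Ac d)
    (f₀ : ℂ) (p q : ι) (hpq : p ≠ q)
    (hf₀ : ∀ j, foldedEntry Ω d j = f₀ ↔ j = p ∨ j = q)
    (hA₁ : matrixFourierCoeff Ω (Ac 1) 0 = 0) :
    (∃ P F, IsFloquetForm Ω A d P F) ∧
    ∀ P F, IsFloquetForm Ω A d P F →
      (firstCoeff F p q = matrixFourierCoeff Ω (Ac 1)
          (foldingNumber Ω (d p).im - foldingNumber Ω (d q).im) p q ∧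
        firstCoeff F q p = matrixFourierCoeff Ω (Ac 1)
          (foldingNumber Ω (d q).im - foldingNumber Ω (d p).im) q p) ∧
      (IsResonatorSystem Ω ε₀ A →
        ∀ s : ℂ, s ^ 2 = firstCoeff F p q * firstCoeff F q p → HasSplitting F f₀ s) ∧
      ((firstCoeff F p q = 0 ↔ firstCoeff F q p = 0) →
        ∀ s : ℂ, s ^ 2 = firstCoeff F p q * firstCoeff F q p → HasSplitting F f₀ s) := by
  refine ⟨hA.exists_isFloquetForm hΩ hε₀, fun P F hF => ?_⟩
  have hp : foldedEntry Ω d p = f₀ := (hf₀ p).2 (Or.inl rfl)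
  have hq : foldedEntry Ω d q = f₀ := (hf₀ q).2 (Or.inr rfl)
  have hdiag (j : ι) : firstCoeff F j j = 0 := by
    rw [hF.firstCoeff_eq hΩ hε₀ hA rfl, sub_self, hA₁]
    rfl
  have hsplit (h0 : firstCoeff F p q = 0 ↔ firstCoeff F q p = 0) (s : ℂ)
      (hs : s ^ 2 = firstCoeff F p q * firstCoeff F q p) : HasSplitting F f₀ s :=
    hasSplitting_of_analytic hpq hf₀ hF.analytic_F hF.zero (hdiag p) (hdiag q) h0 hs
  exact ⟨⟨hF.firstCoeff_eq hΩ hε₀ hA (hp.trans hq.symm),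
    hF.firstCoeff_eq hΩ hε₀ hA (hq.trans hp.symm)⟩,
    fun hR => hsplit (hR.firstCoeff_eq_zero_iff hΩ hε₀ hA hf₀ hA₁ hF), hsplit⟩
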